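/- Let $\Bbbk$ be a field of characteristic $2$. (1) Let $B$ be the $\Bbbk$-algebra given by generators $a,b,c,d$ and defining relations $$a^2=b^2=c^2=d^2=0,$$ $$ba+db+ad=ca+bc+ab=da+cd+ac=cb+dc+bd=0,$$ $$cad+bac+dab=0.$$ Then the following $36$ monomials form a basis of $B$: $$1,\ a,b,c,d,\ ab,ac,ad,ba,bc,bd,cb,cd,$$ $$aba,abc,abd,acb,acd,bac,bad,bcb,bcd,cbd,$$ $$abac,abad,abcb,abcd,acbd,bacb,bacd,bcbd,$$ $$abacb,abacd,abcbd,bacbd,\ abacbd.$$ (2) Let $X=\{1,2,3,4\}$ be the rack of the tetrahedron: $i\triangleright j$ is defined by $\pi_{i\triangleright j}=\pi_i\pi_j\pi_i^{-1}$, where $\pi_1=(2\,3\,4)$, $\pi_2=(1\,4\,3)$, $\pi_3=(1\,2\,4)$, $\pi_4=(1\,3\,2)$ are the elements of the conjugacy class of $(2\,3\,4)$ in $\mathbb{A}_4$, and permutations are composed from right to left as maps. Let $G_X$ be the enveloping group of $X$, that is, the group with generators $x_1,x_2,x_3,x_4$ and relations $x_ix_jx_i^{-1}=x_{i\triangleright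 j}$ for all $i,j\in X$. Then $x_1$ and $x_2x_4=x_3x_2=x_4x_3$ belong to the centralizer $C_{G_X}(x_1)$ of $x_1$. Let $\rho$ be an absolutely simple representation of $C_{G_X}(x_1)$ over $\Bbbk$ such that $\rho(x_1)=-1$ and $\rho(x_2x_4)=1$. Let $V=M(x_1,\rho)$ be the Yetter-Drinfeld module $\mathrm{Ind}_{C_{G_X}(x_1)}^{G_X}\rho$ over $\Bbbk G_X$ with coaction $\delta(h\otimes w)=hx_1h^{-1}\otimes(h\otimes w)$, let $V_{x_1}=\{u\in V\mid\delta(u)=x_1\otimes u\}$, let $v\in V_{x_1}\setminus\{0\}$, and define $$v_1=v,\quad v_2=x_3v,\quad v_3=x_4v,\quad v_4=x_2v.$$ Then $v_1,v_2,v_3,v_4$ form a basis of $V$, and the linear map $V\to B$ given by $(v_1,v_2,v_3,v_4)\mapsto(a,b,c,d)$ extends uniquely to an algebra isomorphism $\mathfrak{B}(V)\to B$ from the Nichols algebra of $V$ (with respect to the braiding $u\otimes w\mapsto u_{(-1)}w\otimes u_{(0)}$). In particular $\dim\mathfrak{B}(V)=36$. -/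

import Mathlib

open scoped TensorProduct

universe u w

noncomputable section

/-! ### Representations: extension of scalars and absolute simplicity -/

section AbsolutelySimple

variable {K : Type u} [Field K] {G W : Type*} [Group G] [AddCommGroup W] [Module K W]

/-- The representation `L ⊗ W` over `L` obtained from `W` by extension of scalars. -/
def scalarExtension (L : Type*) [Field L] [Algebra K L] (ρ : Representation K G W) :
    Representation L G (L ⊗[K] W) where
  toFun g := (ρ g).baseChange L
  map_one' := by rw [map_one]; exact LinearMap.baseChange_id
  map_mul' g h := by rw [map_mul]; exact LinearMap.baseChange_comp _ _

/-- A representation is absolutely simple if it is simple after every extension of scalars. -/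
def IsAbsolutelySimple (ρ : Representation K G W) : Prop :=
  ∀ (L : Type u) [Field L] [Algebra K L], (scalarExtension L ρ).IsIrreducible

end AbsolutelySimple

/-! ### Yetter-Drinfeld modules over a group algebra -/

section YetterDrinfeld

/-- A (left) Yetter-Drinfeld module structure over the group algebra `K[G]` on `V`: an action of
`G`, a left `K[G]`-comodule structure `δ`, and `δ (h v) = h v₍₋₁₎ h⁻¹ ⊗ h v₍₀₎`. -/
structure YDModule (K G V : Type*) [Field K] [Group G] [AddCommGroup V] [Module K V] where
  action : Representation K G V
  coaction : V →ₗ[K] MonoidAlgebra K G ⊗[K] V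
  counit_coaction :
    (TensorProduct.lid K V).toLinearMap ∘ₗ
      (Coalgebra.counit (R := K) (A := MonoidAlgebra K G)).rTensor V ∘ₗ coaction = LinearMap.id
  coassoc :
    (TensorProduct.assoc K (MonoidAlgebra K G) (MonoidAlgebra K G) V).toLinearMap ∘ₗ
      (Coalgebra.comul (R := K) (A := MonoidAlgebra K G)).rTensor V ∘ₗ coaction =
    coaction.lTensor (MonoidAlgebra K G) ∘ₗ coaction
  compat : ∀ h : G, coaction ∘ₗ action h =
    TensorProduct.map (MonoidAlgebra.mapDomainLinearMap K K (fun g : G => h * g * h⁻¹)) (action h)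
      ∘ₗ coaction

namespace YDModule

variable {K G V : Type*} [Field K] [Group G] [AddCommGroup V] [Module K V]

/-- The homogeneous component `V_g = {v | δ v = g ⊗ v}`. -/
def component (M : YDModule K G V) (g : G) : Submodule K V :=
  LinearMap.ker (M.coaction - TensorProduct.mk K (MonoidAlgebra K G) V (MonoidAlgebra.single g 1))

theorem mem_component (M : YDModule K G V) (g : G) (v : V) :
    v ∈ M.component g ↔ M.coaction v = MonoidAlgebra.single g 1 ⊗ₜ[K] v := by
  simp [component, sub_eq_zero]

/-- The braiding `c (v ⊗ w) = v₍₋₁₎ w ⊗ v₍₀₎`. -/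
def braiding (M : YDModule K G V) : V ⊗[K] V →ₗ[K] V ⊗[K] V :=
  TensorProduct.lift M.action.asAlgebraHom.toLinearMap |>.rTensor V
    |>.comp (TensorProduct.assoc K (MonoidAlgebra K G) V V).symm.toLinearMap
    |>.comp ((TensorProduct.comm K V V).toLinearMap.lTensor (MonoidAlgebra K G))
    |>.comp (TensorProduct.assoc K (MonoidAlgebra K G) V V).toLinearMap
    |>.comp (M.coaction.rTensor V)

theorem braiding_tmul (M : YDModule K G V) (g : G) (v w : V) (hv : v ∈ M.component g) :
    M.braiding (v ⊗ₜ w) = M.action g w ⊗ₜ v := by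
  rw [mem_component] at hv
  simp [braiding, hv]

end YDModule

end YetterDrinfeld

/-! ### The Yetter-Drinfeld module `M(g, ρ)` -/

section Induced

variable {K G W : Type*} [Field K] [Group G] [AddCommGroup W] [Module K W]

/-- The underlying space of the `G`-module induced from a representation of the centralizer
of `g`. The element `h ⊗ w` of the induced module is `Representation.IndV.mk _ ρ h⁻¹ w`. -/
abbrev InducedSpace (g : G) (ρ : Representation K (Subgroup.centralizer {g}) W) :=
  Representation.IndV (Subgroup.centralizer {g}).subtype ρ

/-- The coaction `δ (h ⊗ w) = h g h⁻¹ ⊗ (h ⊗ w)` on the induced module. -/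
def inducedCoaction (g : G) (ρ : Representation K (Subgroup.centralizer {g}) W) :
    InducedSpace g ρ →ₗ[K] MonoidAlgebra K G ⊗[K] InducedSpace g ρ :=
  Representation.Coinvariants.lift _
    (TensorProduct.lift
      ((Finsupp.lift _ K G (fun h : G =>
          (TensorProduct.mk K (MonoidAlgebra K G) (InducedSpace g ρ)
            (MonoidAlgebra.single (h⁻¹ * g * h) 1)) ∘ₗ Representation.IndV.mk _ ρ h)) ∘ₗ
        (MonoidAlgebra.coeffLinearEquiv K).toLinearMap))
    (by
      rintro ⟨z, hz⟩
      have hz' := Subgroup.mem_centralizer_singleton_iff.1 hz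
      ext h a
      have key : (z * h)⁻¹ * g * (z * h) = h⁻¹ * g * h := by
        have : z⁻¹ * g * z = g := by rw [mul_assoc, ← hz', inv_mul_cancel_left]
        calc (z * h)⁻¹ * g * (z * h) = h⁻¹ * (z⁻¹ * g * z) * h := by group
          _ = _ := by rw [this]
      have hmk : Representation.IndV.mk (Subgroup.centralizer {g}).subtype ρ (z * h)
          (ρ ⟨z, hz⟩ a) = Representation.IndV.mk _ ρ h a := by
        have := Representation.Coinvariants.mk_self_apply
          (Representation.tprod ((Representation.leftRegular K G).comp
            (Subgroup.centralizer {g}).subtype) ρ) ⟨z, hz⟩ (MonoidAlgebra.single h 1 ⊗ₜ a)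
        simpa using this
      rw [mul_inv_rev] at key
      simp [key] at hmk ⊢
      rw [hmk])

theorem inducedCoaction_mk (g : G) (ρ : Representation K (Subgroup.centralizer {g}) W)
    (h : G) (a : W) :
    inducedCoaction g ρ (Representation.IndV.mk _ ρ h a) =
      MonoidAlgebra.single (h⁻¹ * g * h) 1 ⊗ₜ Representation.IndV.mk _ ρ h a := by
  simp [inducedCoaction]

/-- `M(g, ρ)`: the induced module `Ind ρ` from the centralizer of `g` to `G`, with coaction
`δ (h ⊗ w) = h g h⁻¹ ⊗ (h ⊗ w)`. -/
def inducedYD (g : G) (ρ : Representation K (Subgroup.centralizer {g}) W) :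
    YDModule K G (InducedSpace g ρ) where
  action := Representation.ind _ ρ
  coaction := inducedCoaction g ρ
  counit_coaction := by
    refine Representation.IndV.hom_ext _ _ fun h => LinearMap.ext fun a => ?_
    change TensorProduct.lid K _ ((Coalgebra.counit (R := K) (A := MonoidAlgebra K G)).rTensor _
      (inducedCoaction g ρ (Representation.IndV.mk _ ρ h a))) = Representation.IndV.mk _ ρ h a
    rw [inducedCoaction_mk]
    simp
  coassoc := by
    refine Representation.IndV.hom_ext _ _ fun h => LinearMap.ext fun a => ?_
    change TensorProduct.assoc K _ _ _
      ((Coalgebra.comul (R := K) (A := MonoidAlgebra K G)).rTensor _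
        (inducedCoaction g ρ (Representation.IndV.mk _ ρ h a))) =
      (inducedCoaction g ρ).lTensor _ (inducedCoaction g ρ (Representation.IndV.mk _ ρ h a))
    rw [inducedCoaction_mk, LinearMap.lTensor_tmul, inducedCoaction_mk]
    simp
  compat k := by
    refine Representation.IndV.hom_ext _ _ fun h => LinearMap.ext fun a => ?_
    change inducedCoaction g ρ (Representation.ind _ ρ k (Representation.IndV.mk _ ρ h a)) =
      TensorProduct.map _ (Representation.ind _ ρ k)
        (inducedCoaction g ρ (Representation.IndV.mk _ ρ h a))
    rw [Representation.ind_mk, inducedCoaction_mk, inducedCoaction_mk, TensorProduct.map_tmul,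
      Representation.ind_mk]
    simp [mul_assoc]

end Induced

/-! ### Nichols algebras -/

section Nichols

variable {K V : Type*} [Field K] [AddCommGroup V] [Module K V]

/-- The multiplication `V ⊗ T(V) → T(V)`. -/
def mulLeftTensor (K V : Type*) [Field K] [AddCommGroup V] [Module K V] :
    V ⊗[K] TensorAlgebra K V →ₗ[K] TensorAlgebra K V :=
  TensorProduct.lift (LinearMap.mul K (TensorAlgebra K V) ∘ₗ TensorAlgebra.ι K)

/-- `v ⊗ (w ⊗ t) ↦ ∑ w' ⊗ v' t`, where `c (v ⊗ w) = ∑ w' ⊗ v'`. On `V ⊗ (V ⊗ V^{⊗ n})`, this is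
the braiding of the first two tensor factors. -/
def braidFirst (c : V ⊗[K] V →ₗ[K] V ⊗[K] V) :
    V ⊗[K] (V ⊗[K] TensorAlgebra K V) →ₗ[K] V ⊗[K] TensorAlgebra K V :=
  (mulLeftTensor K V).lTensor V ∘ₗ
    (TensorProduct.assoc K V V (TensorAlgebra K V)).toLinearMap ∘ₗ
      c.rTensor (TensorAlgebra K V) ∘ₗ
        (TensorProduct.assoc K V V (TensorAlgebra K V)).symm.toLinearMap

/-- The operator on `T(V) × (V ⊗ T(V))` used to define `shuffle` recursively. -/
def shuffleAux (c : V ⊗[K] V →ₗ[K] V ⊗[K] V) :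
    V →ₗ[K] Module.End K (TensorAlgebra K V × V ⊗[K] TensorAlgebra K V) :=
  LinearMap.mk₂ K
    (fun v p => (TensorAlgebra.ι K v * p.1, v ⊗ₜ[K] p.1 + braidFirst c (v ⊗ₜ[K] p.2)))
    (fun v v' p => by ext <;> simp [add_mul, TensorProduct.add_tmul]; abel)
    (fun r v p => by ext <;> simp [← TensorProduct.smul_tmul'])
    (fun v p q => by ext <;> simp [mul_add, TensorProduct.tmul_add]; abel)
    (fun r v p => by ext <;> simp)

/-- The linear map `T(V) → V ⊗ T(V)` which vanishes on `K` and satisfies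
`shuffle (v x) = v ⊗ x + braidFirst (v ⊗ shuffle x)` for `v ∈ V`. Its restriction to
`V^{⊗ n} → V ⊗ V^{⊗ (n - 1)} = V^{⊗ n}` is `1 + c₁ + c₁ c₂ + ⋯ + c₁ c₂ ⋯ cₙ₋₁`, where `cᵢ` is
the braiding of the tensor factors `i` and `i + 1`. -/
def shuffle (c : V ⊗[K] V →ₗ[K] V ⊗[K] V) :
    TensorAlgebra K V →ₗ[K] V ⊗[K] TensorAlgebra K V :=
  LinearMap.snd K _ _ ∘ₗ LinearMap.applyₗ (1, 0) ∘ₗ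
    (TensorAlgebra.lift K (shuffleAux c)).toLinearMap

theorem shuffle_one (c : V ⊗[K] V →ₗ[K] V ⊗[K] V) : shuffle c 1 = 0 := by
  simp [shuffle]

theorem shuffle_ι_mul (c : V ⊗[K] V →ₗ[K] V ⊗[K] V) (v : V) (x : TensorAlgebra K V) :
    shuffle c (TensorAlgebra.ι K v * x) = v ⊗ₜ x + braidFirst c (v ⊗ₜ shuffle c x) := by
  have h : ∀ x : TensorAlgebra K V, (TensorAlgebra.lift K (shuffleAux c) x (1, 0)).1 = x := by
    intro x
    have key : ∀ p, (TensorAlgebra.lift K (shuffleAux c) x p).1 = x * p.1 := by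
      induction x using TensorAlgebra.induction with
      | algebraMap r => intro p; simp [Algebra.smul_def, Module.algebraMap_end_apply]
      | ι v => intro p; simp [shuffleAux]
      | mul a b ha hb => intro p; simp [ha, hb, mul_assoc]
      | add a b ha hb => intro p; simp [ha, hb, add_mul]
    simpa using key (1, 0)
  have h' : shuffle c (TensorAlgebra.ι K v * x) =
      (shuffleAux c v (TensorAlgebra.lift K (shuffleAux c) x (1, 0))).2 := by
    simp [shuffle]
  rw [h']
  change v ⊗ₜ[K] (TensorAlgebra.lift K (shuffleAux c) x (1, 0)).1 + _ = _
  rw [h]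
  rfl

/-- The quantum symmetrizer `Sₙ = (id ⊗ Sₙ₋₁) (1 + c₁ + c₁ c₂ + ⋯ + c₁ c₂ ⋯ cₙ₋₁)`, that is, the sum
over all permutations of the associated (Matsumoto) lifts to the braid group. It is the `n`-th
quantum symmetrizer on the component `V^{⊗ n}` of `T(V)`, and it is only used there. -/
def quantumSymmetrizer (c : V ⊗[K] V →ₗ[K] V ⊗[K] V) :
    ℕ → TensorAlgebra K V →ₗ[K] TensorAlgebra K V
  | 0 => LinearMap.id
  | n + 1 => mulLeftTensor K V ∘ₗ (quantumSymmetrizer c n).lTensor V ∘ₗ shuffle c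

/-- The homogeneous elements of `T(V)` which lie in the kernel of a quantum symmetrizer are set
equal to zero in the Nichols algebra. -/
inductive NicholsRel (c : V ⊗[K] V →ₗ[K] V ⊗[K] V) :
    TensorAlgebra K V → TensorAlgebra K V → Prop
  | ker (n : ℕ) (x : TensorAlgebra K V)
      (hx : x ∈ (LinearMap.range (TensorAlgebra.ι K : V →ₗ[K] TensorAlgebra K V)) ^ n)
      (h : quantumSymmetrizer c n x = 0) : NicholsRel c x 0

/-- The Nichols algebra of the braided vector space `(V, c)`: the quotient of the tensor algebra
by the ideal `⨁ₙ ker Sₙ`. -/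
abbrev NicholsAlgebra (c : V ⊗[K] V →ₗ[K] V ⊗[K] V) := RingQuot (NicholsRel c)

/-- The canonical map from `V` to its Nichols algebra. -/
def NicholsAlgebra.ι (c : V ⊗[K] V →ₗ[K] V ⊗[K] V) : V →ₗ[K] NicholsAlgebra c :=
  (RingQuot.mkAlgHom K (NicholsRel c)).toLinearMap ∘ₗ TensorAlgebra.ι K

end Nichols

/-! ### The rack of the tetrahedron -/

section Tetrahedron

/-- The `3`-cycles `(2 3 4)`, `(1 4 3)`, `(1 2 4)`, `(1 3 2)`, where the points `1, 2, 3, 4` are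
represented by the elements `0, 1, 2, 3` of `Fin 4`. -/
def tetraPerm : Fin 4 → Equiv.Perm (Fin 4) :=
  ![c[1, 2, 3], c[0, 3, 2], c[0, 1, 3], c[0, 2, 1]]

/-- The elements `1, 2, 3, 4` (in this order) of the rack of the tetrahedron. -/
def TetraRack : Type := Fin 4

/-- `i ▹ j` is the label of the permutation `πᵢ πⱼ πᵢ⁻¹`, see `tetraPerm_act`; with the present
labels this is the image of `j` under `πᵢ`. -/
instance : Rack TetraRack where
  act i j := tetraPerm i j
  self_distrib := by
    have : ∀ x y z : Fin 4, tetraPerm x (tetraPerm y z) =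
      tetraPerm (tetraPerm x y) (tetraPerm x z) := by decide
    exact fun {x y z} => this x y z
  invAct i j := (tetraPerm i)⁻¹ j
  left_inv i j := (tetraPerm i).symm_apply_apply j
  right_inv i j := (tetraPerm i).apply_symm_apply j

theorem tetraPerm_act (i j : TetraRack) :
    tetraPerm (Shelf.act i j : TetraRack) = tetraPerm i * tetraPerm j * (tetraPerm i)⁻¹ := by
  have : ∀ i j : Fin 4, tetraPerm (tetraPerm i j) =
    tetraPerm i * tetraPerm j * (tetraPerm i)⁻¹ := by decide
  exact this i j

theorem tetraPerm_injective : Function.Injective tetraPerm := by decide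

/-- The rack of the tetrahedron is the conjugacy class of `(2 3 4)` in the alternating group. -/
theorem range_tetraPerm : Set.range tetraPerm =
    {p | ∃ q ∈ alternatingGroup (Fin 4), p = q * tetraPerm 0 * q⁻¹} := by
  have : ∀ p, (∃ i, tetraPerm i = p) ↔
    ∃ q, Equiv.Perm.sign q = 1 ∧ p = q * tetraPerm 0 * q⁻¹ := by decide +kernel
  exact Set.ext this

/-- The enveloping group of the rack of the tetrahedron. -/
abbrev TetraGroup := Rack.EnvelGroup TetraRack

/-- The generators `x₁, x₂, x₃, x₄` of the enveloping group; they are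
`tetraX 0`, `tetraX 1`, `tetraX 2`, `tetraX 3`. -/
def tetraX (i : Fin 4) : TetraGroup := Rack.toEnvelGroup TetraRack i

theorem tetraX_mul (i j : Fin 4) :
    tetraX i * tetraX j = tetraX (tetraPerm i j) * tetraX i := by
  have h : tetraX (tetraPerm i j) = tetraX i * tetraX j * (tetraX i)⁻¹ :=
    (Rack.toEnvelGroup TetraRack).map_act (x := i) (y := j)
  rw [h, inv_mul_cancel_right]

theorem tetraX_self_mem : tetraX 0 ∈ Subgroup.centralizer {tetraX 0} :=
  Subgroup.mem_centralizer_singleton_iff.2 rfl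

theorem tetraX_mul_mem : tetraX 1 * tetraX 3 ∈ Subgroup.centralizer {tetraX 0} := by
  rw [Subgroup.mem_centralizer_singleton_iff]
  have h1 : tetraX 3 * tetraX 0 = tetraX 2 * tetraX 3 := tetraX_mul 3 0
  have h2 : tetraX 1 * tetraX 2 = tetraX 0 * tetraX 1 := tetraX_mul 1 2
  rw [mul_assoc, h1, ← mul_assoc, h2, mul_assoc]

/-- Other expressions for the element `x₂ x₄` of the centralizer of `x₁`. -/
theorem tetraX_mul_eq : tetraX 1 * tetraX 3 = tetraX 2 * tetraX 1 ∧
    tetraX 2 * tetraX 1 = tetraX 3 * tetraX 2 :=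
  ⟨tetraX_mul 1 3, tetraX_mul 2 1⟩

end Tetrahedron

/-! ### The algebra with generators `a, b, c, d` -/

section Algebra

variable (K : Type*) [Field K]

/-- The defining relations, where `a, b, c, d` are the generators with the indices
`0, 1, 2, 3`. -/
inductive TetraRel : FreeAlgebra K (Fin 4) → FreeAlgebra K (Fin 4) → Prop
  | sq (i : Fin 4) : TetraRel (.ι K i * .ι K i) 0
  | quad₁ : TetraRel (.ι K 1 * .ι K 0 + .ι K 3 * .ι K 1 + .ι K 0 * .ι K 3) 0
  | quad₂ : TetraRel (.ι K 2 * .ι K 0 + .ι K 1 * .ι K 2 + .ι K 0 * .ι K 1) 0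
  | quad₃ : TetraRel (.ι K 3 * .ι K 0 + .ι K 2 * .ι K 3 + .ι K 0 * .ι K 2) 0
  | quad₄ : TetraRel (.ι K 2 * .ι K 1 + .ι K 3 * .ι K 2 + .ι K 1 * .ι K 3) 0
  | cubic : TetraRel (.ι K 2 * .ι K 0 * .ι K 3 + .ι K 1 * .ι K 0 * .ι K 2 +
      .ι K 3 * .ι K 0 * .ι K 1) 0

/-- The algebra with generators `a, b, c, d` and relations
`a² = b² = c² = d² = 0`, `ba + db + ad = ca + bc + ab = da + cd + ac = cb + dc + bd = 0`,
`cad + bac + dab = 0`. -/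
abbrev TetraAlgebra := RingQuot (TetraRel K)

/-- The generators `a, b, c, d` of the algebra. -/
def tetraGen (i : Fin 4) : TetraAlgebra K := RingQuot.mkAlgHom K (TetraRel K) (FreeAlgebra.ι K i)

/-- The list of the `36` basis monomials. -/
def tetraMonomials : Fin 36 → TetraAlgebra K :=
  let a := tetraGen K 0
  let b := tetraGen K 1
  let c := tetraGen K 2
  let d := tetraGen K 3
  ![1,
    a, b, c, d,
    a * b, a * c, a * d, b * a, b * c, b * d, c * b, c * d,
    a * b * a, a * b * c, a * b * d, a * c * b, a * c * d,
    b * a * c, b * a * d, b * c * b, b * c * d, c * b * d,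
    a * b * a * c, a * b * a * d, a * b * c * b, a * b * c * d,
    a * c * b * d, b * a * c * b, b * a * c * d, b * c * b * d,
    a * b * a * c * b, a * b * a * c * d, a * b * c * b * d, b * a * c * b * d,
    a * b * a * c * b * d]

end Algebra

end

/-!
Over a field of characteristic `2`, the relations of `TetraAlgebra` can be oriented as rewriting
rules for `ca`, `da`, `db`, `dc` and the squares, and imply cubic rules for `bab`, `cba` and `cbc`.
It follows that the algebra equals `U · {1, c, cb} · {1, d}`, where `U` is the subalgebra generated
by `a` and `b`, in which `aba = bab`. Hence the `36` monomials span
(`TetraAlgebra.span_tetraMonomials`).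

Their independence is proved in the Nichols algebra. Let `b` be a basis of `V` and let the braiding
be `bᵢ ⊗ bⱼ ↦ b_{σᵢ j} ⊗ bᵢ`. The components `∂ᵢ` of the shuffle map of `T(V)` are skew derivations,
and `x ∈ V^{⊗ n}` is in the kernel of the quantum symmetrizer if and only if all products of `n`
skew derivations kill `x`. Let the radical consist of the `x ∈ T(V)` such that all products of skew
derivations map `x` to an element without constant term. The Leibniz rule shows that it is a
two-sided ideal, so that it contains the defining ideal of the Nichols algebra
(`IsRackBraiding.mem_radical_of_mkAlgHom_eq_zero`). For the rack of the tetrahedron there are `36`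
products of skew derivations whose constant terms on the `36` monomials form a matrix which is
unitriangular modulo `2`; so the monomials are independent in the Nichols algebra
(`IsRackBraiding.linearIndependent_tetraWord`). As the skew derivatives of the quadratic relations
vanish, and those of the cubic relation are quadratic relations, there is a surjective map from
`TetraAlgebra` onto the Nichols algebra. It maps a spanning family to a linearly independent one, so
it is bijective, and the family is a basis.

The braiding of `M(x₁, ρ)` has this form: the generators `xᵢ` permute the left cosets of the subgroup
generated by `x₁` and `x₂ x₄` with representatives `1, x₃, x₄, x₂`, so this subgroup is the
centralizer of `x₁`. It acts trivially via `ρ`, since `-1 = 1`, so that `ρ` is one-dimensional, and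
`xᵢ vⱼ = v_{i ▹ j}`.
-/

/-! ### The defining relations as rewriting rules -/

namespace TetraAlgebra

variable (K : Type*) [Field K]

local notation "𝐚" => tetraGen K 0
local notation "𝐛" => tetraGen K 1
local notation "𝐜" => tetraGen K 2
local notation "𝐝" => tetraGen K 3

theorem gen_mul_self (i : Fin 4) : tetraGen K i * tetraGen K i = 0 := by
  simpa [tetraGen] using RingQuot.mkAlgHom_rel K (TetraRel.sq (K := K) i)

variable [CharP K 2]

theorem add_self (x : TetraAlgebra K) : x + x = 0 := by
  rw [← two_smul K, CharTwo.two_eq_zero, zero_smul]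

variable {K} in
theorem eq_of_add_eq_zero {x y : TetraAlgebra K} (h : x + y = 0) : x = y := by
  rw [eq_neg_of_add_eq_zero_left h, neg_eq_of_add_eq_zero_left (add_self K y)]

variable {K} in
theorem eq_add_of_add_eq_zero {x y z : TetraAlgebra K} (h : x + y + z = 0) : x = y + z :=
  eq_of_add_eq_zero (by rw [← add_assoc, h])

theorem d_mul_b : 𝐝 * 𝐛 = 𝐛 * 𝐚 + 𝐚 * 𝐝 := by
  have h := RingQuot.mkAlgHom_rel K (TetraRel.quad₁ (K := K))
  simp only [map_add, map_mul, map_zero] at h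
  exact eq_add_of_add_eq_zero (by rw [add_comm (𝐝 * 𝐛)]; exact h)

theorem c_mul_a : 𝐜 * 𝐚 = 𝐛 * 𝐜 + 𝐚 * 𝐛 := by
  have h := RingQuot.mkAlgHom_rel K (TetraRel.quad₂ (K := K))
  simp only [map_add, map_mul, map_zero] at h
  exact eq_add_of_add_eq_zero h

theorem d_mul_a : 𝐝 * 𝐚 = 𝐜 * 𝐝 + 𝐚 * 𝐜 := by
  have h := RingQuot.mkAlgHom_rel K (TetraRel.quad₃ (K := K))
  simp only [map_add, map_mul, map_zero] at h
  exact eq_add_of_add_eq_zero h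

theorem d_mul_c : 𝐝 * 𝐜 = 𝐜 * 𝐛 + 𝐛 * 𝐝 := by
  have h := RingQuot.mkAlgHom_rel K (TetraRel.quad₄ (K := K))
  simp only [map_add, map_mul, map_zero] at h
  exact eq_add_of_add_eq_zero (by rw [add_comm (𝐝 * 𝐜)]; exact h)

theorem c_mul_a_mul_d : 𝐜 * 𝐚 * 𝐝 = 𝐛 * 𝐚 * 𝐜 + 𝐝 * 𝐚 * 𝐛 := by
  have h := RingQuot.mkAlgHom_rel K (TetraRel.cubic (K := K))
  simp only [map_add, map_mul, map_zero] at h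
  exact eq_add_of_add_eq_zero h

/-- The two ways of reducing `d b b` give the braid relation between `a` and `b`. -/
theorem b_mul_a_mul_b : 𝐛 * 𝐚 * 𝐛 = 𝐚 * 𝐛 * 𝐚 := by
  have h : 𝐝 * 𝐛 * 𝐛 = 𝐛 * 𝐚 * 𝐛 + 𝐚 * 𝐝 * 𝐛 := by rw [d_mul_b, add_mul]
  rw [mul_assoc, gen_mul_self, mul_zero] at h
  rw [eq_of_add_eq_zero h.symm, mul_assoc, d_mul_b, mul_add, ← mul_assoc, ← mul_assoc,
    gen_mul_self, zero_mul, add_zero]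

/-- The two ways of reducing `c c a` give the braid relation between `b` and `c`. -/
theorem c_mul_b_mul_c : 𝐜 * 𝐛 * 𝐜 = 𝐛 * 𝐜 * 𝐛 := by
  have h : 𝐜 * (𝐜 * 𝐚) = 𝐜 * 𝐛 * 𝐜 + 𝐜 * 𝐚 * 𝐛 := by
    rw [c_mul_a, mul_add, mul_assoc, ← c_mul_a, mul_assoc]
  rw [← mul_assoc, gen_mul_self, zero_mul] at h
  rw [eq_of_add_eq_zero h.symm, c_mul_a, add_mul, mul_assoc 𝐚, gen_mul_self, mul_zero, add_zero]

/-- The two ways of reducing `c d b`, with `c a d` eliminated by the cubic relation. -/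
theorem c_mul_b_mul_a : 𝐜 * 𝐛 * 𝐚 = 𝐚 * 𝐜 * 𝐛 + 𝐛 * 𝐚 * 𝐜 := by
  have h1 : 𝐜 * 𝐝 * 𝐛 = 𝐜 * 𝐛 * 𝐚 + 𝐜 * 𝐚 * 𝐝 := by
    rw [mul_assoc, d_mul_b, mul_add, ← mul_assoc, ← mul_assoc]
  have h2 : 𝐝 * 𝐚 * 𝐛 = 𝐜 * 𝐝 * 𝐛 + 𝐚 * 𝐜 * 𝐛 := by rw [d_mul_a, add_mul]
  rw [h1, c_mul_a_mul_d] at h2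
  refine eq_of_add_eq_zero ?_
  have h3 := add_self K (𝐝 * 𝐚 * 𝐛)
  nth_rewrite 1 [h2] at h3
  have h4 := add_self K (𝐝 * 𝐚 * 𝐛)
  have h5 : 𝐜 * 𝐛 * 𝐚 + (𝐚 * 𝐜 * 𝐛 + 𝐛 * 𝐚 * 𝐜) + (𝐝 * 𝐚 * 𝐛 + 𝐝 * 𝐚 * 𝐛) = 0 := by
    rw [← h3]; abel
  rwa [h4, add_zero] at h5

/-! ### The monomials span -/

/-- The subalgebra generated by `a` and `b`, as a subspace. -/
def subalgAB : Submodule K (TetraAlgebra K) :=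
  Subalgebra.toSubmodule (Algebra.adjoin K {𝐚, 𝐛})

/-- The elements `v w` with `v ∈ {1, c, cb}` and `w ∈ {1, d}`: they generate the algebra as a left
module over the subalgebra generated by `a` and `b`. -/
def leftGens : Set (TetraAlgebra K) := {1, 𝐜, 𝐜 * 𝐛, 𝐝, 𝐜 * 𝐝, 𝐜 * 𝐛 * 𝐝}

/-- The subalgebra generated by `a` and `b` is spanned by the elements of the Coxeter group `S₃`. -/
theorem subalgAB_le :
    subalgAB K ≤ Submodule.span K {1, 𝐚, 𝐛, 𝐚 * 𝐛, 𝐛 * 𝐚, 𝐚 * 𝐛 * 𝐚} := by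
  set S := Submodule.span K {1, 𝐚, 𝐛, 𝐚 * 𝐛, 𝐛 * 𝐚, 𝐚 * 𝐛 * 𝐚} with hS
  have h1 : (1 : TetraAlgebra K) ∈ S := Submodule.subset_span (by simp)
  have h2 : 𝐚 ∈ S := Submodule.subset_span (by simp)
  have h3 : 𝐛 ∈ S := Submodule.subset_span (by simp)
  have h4 : 𝐚 * 𝐛 ∈ S := Submodule.subset_span (by simp)
  have h5 : 𝐛 * 𝐚 ∈ S := Submodule.subset_span (by simp)
  have h6 : 𝐚 * 𝐛 * 𝐚 ∈ S := Submodule.subset_span (by simp)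
  have key : S * Submodule.span K {𝐚, 𝐛} ≤ S := by
    rw [hS, Submodule.span_mul_span, ← hS, Submodule.span_le]
    rintro _ ⟨x, hx, y, hy, rfl⟩
    have e1 : 𝐛 * 𝐚 * 𝐚 = 0 := by rw [mul_assoc, gen_mul_self, mul_zero]
    have e2 : 𝐚 * 𝐛 * 𝐛 = 0 := by rw [mul_assoc, gen_mul_self, mul_zero]
    have e3 : 𝐚 * 𝐛 * 𝐚 * 𝐚 = 0 := by rw [mul_assoc, gen_mul_self, mul_zero]
    have e4 : 𝐚 * 𝐛 * 𝐚 * 𝐛 = 0 := by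
      rw [mul_assoc, mul_assoc, ← mul_assoc 𝐛, b_mul_a_mul_b, ← mul_assoc, ← mul_assoc,
        gen_mul_self, zero_mul, zero_mul]
    simp only [Set.mem_insert_iff, Set.mem_singleton_iff] at hx hy
    rcases hx with rfl | rfl | rfl | rfl | rfl | rfl <;> rcases hy with rfl | rfl <;>
      simp only [one_mul, gen_mul_self, e1, e2, e3, e4, b_mul_a_mul_b, SetLike.mem_coe, zero_mem,
        h2, h3, h4, h5, h6]
  intro x hx
  change x ∈ Algebra.adjoin K {𝐚, 𝐛} at hx
  have : ∀ s ∈ S, s * x ∈ S := by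
    induction hx using Algebra.adjoin_induction with
    | mem x hx => exact fun s hs => key (Submodule.mul_mem_mul hs (Submodule.subset_span hx))
    | algebraMap r =>
      intro s hs
      rw [← Algebra.commutes, ← Algebra.smul_def]
      exact S.smul_mem r hs
    | add x y _ _ hx hy => intro s hs; rw [mul_add]; exact S.add_mem (hx s hs) (hy s hs)
    | mul x y _ _ hx hy => intro s hs; rw [← mul_assoc]; exact hy _ (hx s hs)
  simpa using this 1 h1

/-- The left module over the subalgebra generated by `a` and `b` which `leftGens` generates is
stable under right multiplication by the generators. -/
theorem leftGens_mul_le :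
    Submodule.span K (leftGens K) * Submodule.span K (Set.range (tetraGen K)) ≤
      subalgAB K * Submodule.span K (leftGens K) := by
  rw [Submodule.span_mul_span, Submodule.span_le]
  rintro _ ⟨x, hx, y, ⟨i, rfl⟩, rfl⟩
  have ha : 𝐚 ∈ subalgAB K := Algebra.subset_adjoin (by simp)
  have hb : 𝐛 ∈ subalgAB K := Algebra.subset_adjoin (by simp)
  have h1 : (1 : TetraAlgebra K) ∈ subalgAB K := one_mem (Algebra.adjoin K {𝐚, 𝐛})
  have hm : ∀ {x y}, x ∈ subalgAB K → y ∈ subalgAB K → x * y ∈ subalgAB K :=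
    fun hx hy => mul_mem (S := Subalgebra K (TetraAlgebra K)) hx hy
  have mem : ∀ u ∈ subalgAB K, ∀ x ∈ leftGens K,
      u * x ∈ subalgAB K * Submodule.span K (leftGens K) :=
    fun u hu x hx => Submodule.mul_mem_mul hu (Submodule.subset_span hx)
  have mem' : ∀ x ∈ leftGens K, x ∈ subalgAB K * Submodule.span K (leftGens K) :=
    fun x hx => by simpa using mem 1 h1 x hx
  have memU : ∀ u ∈ subalgAB K, u ∈ subalgAB K * Submodule.span K (leftGens K) :=
    fun u hu => by simpa using mem u hu 1 (by simp [leftGens])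
  -- The products `x y` with `x ∈ leftGens` and a generator `y`, as combinations of elements
  -- `u x'` with `u` in the subalgebra generated by `a` and `b`, and `x' ∈ leftGens`.
  have e1 : 𝐜 * 𝐛 * 𝐛 = 0 := by rw [mul_assoc, gen_mul_self, mul_zero]
  have e2 : 𝐜 * 𝐝 * 𝐚 = 𝐚 * 𝐛 * 𝐜 := by
    rw [mul_assoc, d_mul_a, mul_add, ← mul_assoc, ← mul_assoc, gen_mul_self, zero_mul, zero_add,
      c_mul_a, add_mul, mul_assoc 𝐛, gen_mul_self, mul_zero, zero_add]
  have e3 : 𝐜 * 𝐝 * 𝐛 = 𝐚 * (𝐜 * 𝐛) + 𝐛 * 𝐚 * 𝐜 + (𝐛 * (𝐜 * 𝐝) + 𝐚 * 𝐛 * 𝐝) := by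
    rw [mul_assoc, d_mul_b, mul_add, ← mul_assoc, ← mul_assoc, c_mul_b_mul_a, c_mul_a, add_mul,
      mul_assoc, mul_assoc 𝐛 𝐜]
  have e4 : 𝐜 * 𝐝 * 𝐜 = 𝐜 * 𝐛 * 𝐝 := by
    rw [mul_assoc, d_mul_c, mul_add, ← mul_assoc, ← mul_assoc, gen_mul_self, zero_mul, zero_add]
  have e5 : ∀ x, x * 𝐝 * 𝐝 = 0 := fun x => by rw [mul_assoc, gen_mul_self, mul_zero]
  have e6 : 𝐜 * 𝐛 * 𝐝 * 𝐚 = 𝐛 * (𝐜 * 𝐛 * 𝐝) + 𝐚 * 𝐛 * (𝐜 * 𝐛) := by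
    rw [mul_assoc, d_mul_a, mul_add, ← mul_assoc, ← mul_assoc, c_mul_b_mul_c, c_mul_b_mul_a,
      add_mul, mul_assoc (𝐛 * 𝐚), gen_mul_self, mul_zero, add_zero, mul_assoc, mul_assoc,
      mul_assoc 𝐚, mul_assoc 𝐚, c_mul_b_mul_c]
    simp only [mul_assoc]
  have e7 : 𝐜 * 𝐛 * 𝐝 * 𝐛 = 𝐚 * (𝐜 * 𝐛 * 𝐝) + 𝐛 * 𝐚 * (𝐜 * 𝐝) := by
    rw [mul_assoc, d_mul_b, mul_add, ← mul_assoc, ← mul_assoc, e1, zero_mul, zero_add,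
      c_mul_b_mul_a, add_mul]
    simp only [mul_assoc]
  have e8 : 𝐜 * 𝐛 * 𝐝 * 𝐜 = 0 := by
    rw [mul_assoc, d_mul_c, mul_add, ← mul_assoc, ← mul_assoc, e1, zero_mul, add_zero,
      c_mul_b_mul_c, mul_assoc, gen_mul_self, mul_zero]
  have e9 : 𝐜 * 𝐛 * 𝐚 = 𝐚 * (𝐜 * 𝐛) + 𝐛 * 𝐚 * 𝐜 := by rw [c_mul_b_mul_a, mul_assoc 𝐚]
  have e10 : 𝐜 * 𝐛 * 𝐜 = 𝐛 * (𝐜 * 𝐛) := by rw [c_mul_b_mul_c, mul_assoc]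
  simp only [leftGens, Set.mem_insert_iff, Set.mem_singleton_iff] at hx
  rcases hx with rfl | rfl | rfl | rfl | rfl | rfl <;> fin_cases i <;>
    simp only [Fin.zero_eta, Fin.mk_one, Fin.reduceFinMk, one_mul, gen_mul_self, e1, e2, e3, e4,
      e5, e6, e7, e8, e9, e10, c_mul_a, d_mul_a, d_mul_b, d_mul_c, SetLike.mem_coe, zero_mem] <;>
    repeat' first
    | apply Submodule.add_mem
    | (refine memU _ ?_; simp only [ha, hb, hm])
    | (refine mem _ ?_ _ ?_ <;> [simp only [ha, hb, hm]; simp [leftGens]])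
    | (refine mem' _ ?_; simp [leftGens])

theorem subalgAB_mul_leftGens :
    subalgAB K * Submodule.span K (leftGens K) = ⊤ := by
  set S := subalgAB K * Submodule.span K (leftGens K) with hS
  have key : S * Submodule.span K (Set.range (tetraGen K)) ≤ S :=
    calc _ = subalgAB K * (Submodule.span K (leftGens K) *
            Submodule.span K (Set.range (tetraGen K))) := by rw [hS, mul_assoc]
      _ ≤ subalgAB K * (subalgAB K * Submodule.span K (leftGens K)) :=
        mul_le_mul_right (leftGens_mul_le K) _
      _ = S := by
        rw [← mul_assoc, show subalgAB K * subalgAB K = subalgAB K from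
          Subalgebra.isIdempotentElem_toSubmodule _]
  have h1 : (1 : TetraAlgebra K) ∈ S := by
    have h : (1 : TetraAlgebra K) ∈ Submodule.span K (leftGens K) :=
      Submodule.subset_span (by simp [leftGens])
    have h' : (1 : TetraAlgebra K) ∈ subalgAB K := one_mem (Algebra.adjoin K {𝐚, 𝐛})
    simpa using Submodule.mul_mem_mul h' h
  rw [eq_top_iff]
  rintro x -
  obtain ⟨y, rfl⟩ := RingQuot.mkAlgHom_surjective K (TetraRel K) x
  have : ∀ s ∈ S, s * RingQuot.mkAlgHom K (TetraRel K) y ∈ S := by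
    induction y using FreeAlgebra.induction with
    | grade0 r =>
      intro s hs
      rw [AlgHom.commutes, ← Algebra.commutes, ← Algebra.smul_def]
      exact S.smul_mem r hs
    | grade1 i =>
      exact fun s hs => key (Submodule.mul_mem_mul hs (Submodule.subset_span ⟨i, rfl⟩))
    | mul x y hx hy => intro s hs; rw [map_mul, ← mul_assoc]; exact hy _ (hx s hs)
    | add x y hx hy => intro s hs; rw [map_add, mul_add]; exact S.add_mem (hx s hs) (hy s hs)
  simpa using this 1 h1

theorem span_tetraMonomials : Submodule.span K (Set.range (tetraMonomials K)) = ⊤ := by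
  rw [eq_top_iff, ← subalgAB_mul_leftGens]
  refine (mul_le_mul_left (subalgAB_le K) _).trans ?_
  rw [Submodule.span_mul_span]
  refine Submodule.span_mono ?_
  rintro _ ⟨x, hx, y, hy, rfl⟩
  simp only [leftGens, Set.mem_insert_iff, Set.mem_singleton_iff] at hx hy
  rcases hx with rfl | rfl | rfl | rfl | rfl | rfl <;>
    rcases hy with rfl | rfl | rfl | rfl | rfl | rfl <;>
    simp only [tetraMonomials, Matrix.range_cons, Matrix.range_empty, Set.union_empty,
      Set.mem_union, Set.mem_singleton_iff, one_mul, mul_one, ← mul_assoc, true_or, or_true]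

end TetraAlgebra

/-! ### Skew derivations of the tensor algebra -/

noncomputable section SkewDerivations

variable {K V ι : Type*} [Field K] [AddCommGroup V] [Module K V]

/-- `T(V)` is free on the left over `V`: the shuffle map of the zero braiding strips the first
letter. -/
theorem mulLeftTensor_injective : Function.Injective (mulLeftTensor K V) := by
  have h : shuffle 0 ∘ₗ mulLeftTensor K V = LinearMap.id := by
    refine TensorProduct.ext' fun v x => ?_
    simp [mulLeftTensor, shuffle_ι_mul, braidFirst]
  exact Function.LeftInverse.injective (g := shuffle 0) fun x => LinearMap.congr_fun h x

theorem braidFirst_tmul (c : V ⊗[K] V →ₗ[K] V ⊗[K] V) {v w v' w' : V}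
    (h : c (v ⊗ₜ w) = w' ⊗ₜ v') (x : TensorAlgebra K V) :
    braidFirst c (v ⊗ₜ (w ⊗ₜ x)) = w' ⊗ₜ (TensorAlgebra.ι K v' * x) := by
  simp [braidFirst, h, mulLeftTensor]

/-- A subspace of `T(V)` which contains `1` and is stable under left multiplication by the elements
of a basis of `V` is everything. -/
theorem TensorAlgebra.mem_of_ι_mul_mem (b : Module.Basis ι K V)
    (S : Submodule K (TensorAlgebra K V)) (h1 : 1 ∈ S)
    (hS : ∀ i, ∀ x ∈ S, TensorAlgebra.ι K (b i) * x ∈ S) (x : TensorAlgebra K V) : x ∈ S := by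
  have : ∀ s ∈ S, x * s ∈ S := by
    induction x using TensorAlgebra.induction with
    | algebraMap r => intro s hs; rw [← Algebra.smul_def]; exact S.smul_mem r hs
    | ι v =>
      intro s hs
      induction b.mem_span v using Submodule.span_induction with
      | mem _ h => obtain ⟨i, rfl⟩ := h; exact hS i s hs
      | zero => rw [map_zero, zero_mul]; exact S.zero_mem
      | add v w _ _ hv hw => rw [map_add, add_mul]; exact S.add_mem hv hw
      | smul r v _ hv => rw [map_smul, smul_mul_assoc]; exact S.smul_mem r hv
    | mul x y hx hy => intro s hs; rw [mul_assoc]; exact hx _ (hy s hs)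
    | add x y hx hy => intro s hs; rw [add_mul]; exact S.add_mem (hx s hs) (hy s hs)
  simpa using this 1 h1

/-- The coordinates of `V ⊗ T(V)` with respect to a basis of `V`. -/
def tensorCoord (b : Module.Basis ι K V) (i : ι) :
    V ⊗[K] TensorAlgebra K V →ₗ[K] TensorAlgebra K V :=
  (TensorProduct.lid K (TensorAlgebra K V)).toLinearMap ∘ₗ
    (b.coord i).rTensor (TensorAlgebra K V)

theorem tensorCoord_tmul [DecidableEq ι] (b : Module.Basis ι K V) (i j : ι)
    (x : TensorAlgebra K V) :
    tensorCoord b i (b j ⊗ₜ x) = if j = i then x else 0 := by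
  simp [tensorCoord, Finsupp.single_apply, ite_smul]

theorem sum_tensorCoord [Fintype ι] (b : Module.Basis ι K V) (t : V ⊗[K] TensorAlgebra K V) :
    ∑ i, b i ⊗ₜ tensorCoord b i t = t := by
  induction t with
  | zero => simp
  | tmul v x =>
    conv_rhs => rw [← b.sum_repr v, TensorProduct.sum_tmul]
    simp [tensorCoord, TensorProduct.smul_tmul]
  | add t s ht hs => simp only [map_add, TensorProduct.tmul_add, Finset.sum_add_distrib, ht, hs]

/-- The skew derivation `∂ᵢ` of `T(V)`, defined by `shuffle x = ∑ᵢ bᵢ ⊗ ∂ᵢ x`. -/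
def skewDer (b : Module.Basis ι K V) (c : V ⊗[K] V →ₗ[K] V ⊗[K] V) (i : ι) :
    TensorAlgebra K V →ₗ[K] TensorAlgebra K V :=
  tensorCoord b i ∘ₗ shuffle c

theorem skewDer_one (b : Module.Basis ι K V) (c : V ⊗[K] V →ₗ[K] V ⊗[K] V) (i : ι) :
    skewDer b c i 1 = 0 := by
  simp [skewDer, shuffle_one]

/-- The pairing of a word `i₁ ⋯ iₙ` with `x ∈ T(V)`: the constant term of `∂_{iₙ} ⋯ ∂_{i₁} x`. -/
def wordPairing (b : Module.Basis ι K V) (c : V ⊗[K] V →ₗ[K] V ⊗[K] V) :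
    List ι → TensorAlgebra K V →ₗ[K] K
  | [] => TensorAlgebra.algebraMapInv.toLinearMap
  | i :: w => wordPairing b c w ∘ₗ skewDer b c i

/-- The elements of `T(V)` which pair to zero with all words. -/
def radical (b : Module.Basis ι K V) (c : V ⊗[K] V →ₗ[K] V ⊗[K] V) :
    Submodule K (TensorAlgebra K V) :=
  ⨅ w, LinearMap.ker (wordPairing b c w)

theorem mem_radical {b : Module.Basis ι K V} {c : V ⊗[K] V →ₗ[K] V ⊗[K] V}
    {x : TensorAlgebra K V} : x ∈ radical b c ↔ ∀ w, wordPairing b c w x = 0 := by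
  simp [radical, Submodule.mem_iInf]

theorem mem_radical_iff {b : Module.Basis ι K V} {c : V ⊗[K] V →ₗ[K] V ⊗[K] V}
    {x : TensorAlgebra K V} :
    x ∈ radical b c ↔ TensorAlgebra.algebraMapInv x = 0 ∧ ∀ i, skewDer b c i x ∈ radical b c := by
  simp only [mem_radical]
  exact ⟨fun h => ⟨h [], fun i w => h (i :: w)⟩, fun h w => match w with
    | [] => h.1
    | i :: w => h.2 i w⟩

variable [DecidableEq ι]

/-- The braiding `c` permutes the basis `b`: `c (bᵢ ⊗ bⱼ) = b_{σᵢ j} ⊗ bᵢ`. -/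
def IsRackBraiding (b : Module.Basis ι K V) (σ : ι → Equiv.Perm ι)
    (c : V ⊗[K] V →ₗ[K] V ⊗[K] V) : Prop :=
  ∀ i j, c (b i ⊗ₜ b j) = b (σ i j) ⊗ₜ b i

namespace IsRackBraiding

variable {b : Module.Basis ι K V} {σ : ι → Equiv.Perm ι} {c : V ⊗[K] V →ₗ[K] V ⊗[K] V}
  (hc : IsRackBraiding b σ c)

include hc

theorem skewDer_ι_mul (i j : ι) (x : TensorAlgebra K V) :
    skewDer b c i (TensorAlgebra.ι K (b j) * x) =
      (if j = i then x else 0) + TensorAlgebra.ι K (b j) * skewDer b c ((σ j)⁻¹ i) x := by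
  have h : ∀ t : V ⊗[K] TensorAlgebra K V, tensorCoord b i (braidFirst c (b j ⊗ₜ t)) =
      TensorAlgebra.ι K (b j) * tensorCoord b ((σ j)⁻¹ i) t := by
    intro t
    induction t with
    | zero => simp
    | tmul v x =>
      induction b.mem_span v using Submodule.span_induction with
      | mem _ h =>
        obtain ⟨k, rfl⟩ := h
        simp only [braidFirst_tmul c (hc j k), tensorCoord_tmul,
          Equiv.Perm.eq_inv_iff_eq]
        split_ifs <;> simp
      | zero => simp
      | add v w _ _ hv hw => simp only [TensorProduct.add_tmul, TensorProduct.tmul_add, map_add,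
          hv, hw, mul_add]
      | smul r v _ hv => simp only [← TensorProduct.smul_tmul', TensorProduct.tmul_smul, map_smul,
          hv, mul_smul_comm]
    | add t s ht hs => simp only [TensorProduct.tmul_add, map_add, ht, hs, mul_add]
  simp only [skewDer, LinearMap.comp_apply, shuffle_ι_mul, map_add, tensorCoord_tmul, h]

end IsRackBraiding

variable [Fintype ι]

/-- The algebra map `T(V) → Mat(T(V))` whose entry `(i, j)` sends a word `w` in the basis `b` to `w`
if `σ_w j = i`, and to `0` otherwise. These entries are the twists in the Leibniz rule for `∂ᵢ`. -/
def twist (b : Module.Basis ι K V) (σ : ι → Equiv.Perm ι) :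
    TensorAlgebra K V →ₐ[K] Matrix ι ι (TensorAlgebra K V) :=
  TensorAlgebra.lift K (b.constr K fun k => Matrix.of fun i j =>
    if σ k j = i then TensorAlgebra.ι K (b k) else 0)

theorem twist_ι_mul (b : Module.Basis ι K V) (σ : ι → Equiv.Perm ι) (k i j : ι)
    (x : TensorAlgebra K V) :
    twist b σ (TensorAlgebra.ι K (b k) * x) i j =
      TensorAlgebra.ι K (b k) * twist b σ x ((σ k)⁻¹ i) j := by
  simp [twist, Matrix.mul_apply, ← Equiv.Perm.eq_inv_iff_eq, ite_mul]

/-- The entry `(i, j)` of `twist`, as a linear map. -/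
def twistEntry (b : Module.Basis ι K V) (σ : ι → Equiv.Perm ι) (i j : ι) :
    TensorAlgebra K V →ₗ[K] TensorAlgebra K V :=
  Matrix.entryLinearMap K _ i j ∘ₗ (twist b σ).toLinearMap

theorem twistEntry_one (b : Module.Basis ι K V) (σ : ι → Equiv.Perm ι) (i j : ι) :
    twistEntry b σ i j 1 = if i = j then 1 else 0 := by
  simp [twistEntry, Matrix.one_apply]

theorem twistEntry_ι_mul (b : Module.Basis ι K V) (σ : ι → Equiv.Perm ι) (k i j : ι)
    (x : TensorAlgebra K V) :
    twistEntry b σ i j (TensorAlgebra.ι K (b k) * x) =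
      TensorAlgebra.ι K (b k) * twistEntry b σ ((σ k)⁻¹ i) j x :=
  twist_ι_mul b σ k i j x

namespace IsRackBraiding

variable {b : Module.Basis ι K V} {σ : ι → Equiv.Perm ι} {c : V ⊗[K] V →ₗ[K] V ⊗[K] V}
  (hc : IsRackBraiding b σ c)

include hc

/-- The Leibniz rule for a product with a basis element on the right. -/
theorem skewDer_mul_ι (i j : ι) (x : TensorAlgebra K V) :
    skewDer b c i (x * TensorAlgebra.ι K (b j)) =
      skewDer b c i x * TensorAlgebra.ι K (b j) + twistEntry b σ i j x := by
  -- The recursion for `∂ᵢ` changes the index `i`, so that all indices are treated at once.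
  let S : Submodule K (TensorAlgebra K V) :=
    ⨅ i, LinearMap.eqLocus (skewDer b c i ∘ₗ LinearMap.mulRight K (TensorAlgebra.ι K (b j)))
      (LinearMap.mulRight K (TensorAlgebra.ι K (b j)) ∘ₗ skewDer b c i + twistEntry b σ i j)
  have hS : ∀ x, x ∈ S ↔ ∀ i, skewDer b c i (x * TensorAlgebra.ι K (b j)) =
      skewDer b c i x * TensorAlgebra.ι K (b j) + twistEntry b σ i j x := by
    intro x
    simp [S, Submodule.mem_iInf]
  refine (hS x).1 (TensorAlgebra.mem_of_ι_mul_mem b S ?_ ?_ x) i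
  · rw [hS]
    intro i
    have := hc.skewDer_ι_mul i j 1
    rw [mul_one, skewDer_one, mul_zero, add_zero] at this
    rw [one_mul, this, skewDer_one, zero_mul, zero_add, twistEntry_one]
    simp only [eq_comm]
  · intro k x hx
    rw [hS] at hx ⊢
    intro i
    rw [mul_assoc, hc.skewDer_ι_mul, hc.skewDer_ι_mul, hx, twistEntry_ι_mul]
    split_ifs <;> simp only [add_mul, mul_add, zero_mul, mul_assoc, add_assoc]

/-- The twists permute the skew derivations, by the self-distributivity of the rack. -/
theorem skewDer_twistEntry (hσ : ∀ i j, σ (σ i j) = σ i * σ j * (σ i)⁻¹) (k i j : ι)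
    (x : TensorAlgebra K V) :
    skewDer b c k (twistEntry b σ i j x) = twistEntry b σ ((σ k)⁻¹ i) j (skewDer b c k x) := by
  let S : Submodule K (TensorAlgebra K V) :=
    ⨅ (k) (i), LinearMap.eqLocus (skewDer b c k ∘ₗ twistEntry b σ i j)
      (twistEntry b σ ((σ k)⁻¹ i) j ∘ₗ skewDer b c k)
  have hS : ∀ x, x ∈ S ↔ ∀ k i, skewDer b c k (twistEntry b σ i j x) =
      twistEntry b σ ((σ k)⁻¹ i) j (skewDer b c k x) := by
    intro x
    simp [S, Submodule.mem_iInf]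
  refine (hS x).1 (TensorAlgebra.mem_of_ι_mul_mem b S ?_ ?_ x) k i
  · rw [hS]
    intro k i
    rw [twistEntry_one, skewDer_one, map_zero]
    split_ifs <;> simp [skewDer_one]
  · intro l x hx
    rw [hS] at hx ⊢
    intro k i
    have h : (σ ((σ l)⁻¹ k))⁻¹ ((σ l)⁻¹ i) = (σ l)⁻¹ ((σ k)⁻¹ i) := by
      have h := hσ l ((σ l)⁻¹ k)
      rw [show σ l ((σ l)⁻¹ k) = k from (σ l).apply_symm_apply k] at h
      rw [h]
      simp [mul_assoc]
    rw [twistEntry_ι_mul, hc.skewDer_ι_mul, hc.skewDer_ι_mul, map_add, twistEntry_ι_mul, hx, h]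
    split_ifs with hlk
    · rw [hlk]
    · rw [map_zero]

end IsRackBraiding

end SkewDerivations

/-! ### The kernel of the projection onto the Nichols algebra -/

noncomputable section NicholsKernel

variable {K V ι : Type*} [Field K] [AddCommGroup V] [Module K V]
  {b : Module.Basis ι K V} {σ : ι → Equiv.Perm ι} {c : V ⊗[K] V →ₗ[K] V ⊗[K] V}

theorem algebraMapInv_ι (v : V) : TensorAlgebra.algebraMapInv (TensorAlgebra.ι K v) = (0 : K) := by
  simp [TensorAlgebra.algebraMapInv]

variable [DecidableEq ι]

theorem quantumSymmetrizer_succ_eq_zero_iff [Fintype ι] (n : ℕ) (x : TensorAlgebra K V) :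
    quantumSymmetrizer c (n + 1) x = 0 ↔
      ∀ i, quantumSymmetrizer c n (skewDer b c i x) = 0 := by
  have h : quantumSymmetrizer c (n + 1) x = 0 ↔
      (quantumSymmetrizer c n).lTensor V (shuffle c x) = 0 :=
    map_eq_zero_iff (mulLeftTensor K V) mulLeftTensor_injective
  have h' : (quantumSymmetrizer c n).lTensor V (shuffle c x) =
      ∑ i, b i ⊗ₜ quantumSymmetrizer c n (skewDer b c i x) := by
    conv_lhs => rw [← sum_tensorCoord b (shuffle c x)]
    simp [skewDer]
  rw [h, h']
  refine ⟨fun h0 i => ?_, fun h0 => Finset.sum_eq_zero fun i _ => by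
    rw [h0, TensorProduct.tmul_zero]⟩
  have := congrArg (tensorCoord b i) h0
  simpa [tensorCoord_tmul] using this

namespace IsRackBraiding

variable (hc : IsRackBraiding b σ c)

include hc

theorem ι_mul_mem_radical {x : TensorAlgebra K V} (hx : x ∈ radical b c) (j : ι) :
    TensorAlgebra.ι K (b j) * x ∈ radical b c := by
  rw [mem_radical]
  intro w
  induction w generalizing x j with
  | nil => simp [wordPairing, algebraMapInv_ι]
  | cons i w ih =>
    rw [wordPairing, LinearMap.comp_apply, hc.skewDer_ι_mul, map_add,
      ih ((mem_radical_iff.1 hx).2 _), add_zero]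
    split_ifs
    · exact mem_radical.1 hx w
    · rw [map_zero]

theorem mul_mem_radical_left (y : TensorAlgebra K V) {x : TensorAlgebra K V}
    (hx : x ∈ radical b c) : y * x ∈ radical b c := by
  let S : Submodule K (TensorAlgebra K V) :=
    (radical b c).comap (LinearMap.mulRight K x)
  refine TensorAlgebra.mem_of_ι_mul_mem b S ?_ ?_ y
  · simpa [S] using hx
  · intro i z hz
    change TensorAlgebra.ι K (b i) * z * x ∈ radical b c
    rw [mul_assoc]
    exact hc.ι_mul_mem_radical hz i

/-- The skew derivations lower the degree by one. -/
theorem skewDer_mem_pow (n : ℕ) (i : ι) {x : TensorAlgebra K V}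
    (hx : x ∈ LinearMap.range (TensorAlgebra.ι K : V →ₗ[K] TensorAlgebra K V) ^ (n + 1)) :
    skewDer b c i x ∈ LinearMap.range (TensorAlgebra.ι K : V →ₗ[K] TensorAlgebra K V) ^ n := by
  set R := LinearMap.range (TensorAlgebra.ι K : V →ₗ[K] TensorAlgebra K V) with hR
  have hb : R = Submodule.span K (Set.range fun j => TensorAlgebra.ι K (b j)) := by
    rw [hR, LinearMap.range_eq_map, ← b.span_eq, Submodule.map_span, ← Set.range_comp]
    rfl
  induction n generalizing i x with
  | zero =>
    rw [zero_add, pow_one, hb] at hx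
    induction hx using Submodule.span_induction with
    | mem _ h =>
      obtain ⟨j, rfl⟩ := h
      have := hc.skewDer_ι_mul i j 1
      rw [mul_one, skewDer_one, mul_zero, add_zero] at this
      simp only [this, pow_zero]
      split_ifs
      · exact Submodule.one_le.1 le_rfl
      · exact zero_mem _
    | zero => rw [map_zero]; exact zero_mem _
    | add x y _ _ hx hy => rw [map_add]; exact add_mem hx hy
    | smul r x _ hx => rw [map_smul]; exact Submodule.smul_mem _ r hx
  | succ n ih =>
    rw [pow_succ'] at hx
    induction hx using Submodule.mul_induction_on' with
    | mem_mul_mem v hv y hy =>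
      rw [hb] at hv
      induction hv using Submodule.span_induction with
      | mem _ h =>
        obtain ⟨j, rfl⟩ := h
        simp only [hc.skewDer_ι_mul]
        refine add_mem ?_ ?_
        · split_ifs
          · exact hy
          · exact zero_mem _
        · rw [pow_succ']
          exact Submodule.mul_mem_mul (LinearMap.mem_range_self _ _) (ih _ hy)
      | zero => rw [zero_mul, map_zero]; exact zero_mem _
      | add x y _ _ hx hy => rw [add_mul, map_add]; exact add_mem hx hy
      | smul r x _ hx => rw [smul_mul_assoc, map_smul]; exact Submodule.smul_mem _ r hx
    | add x _ y _ hx hy => rw [map_add]; exact add_mem hx hy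

theorem mem_radical_of_quantumSymmetrizer [Fintype ι] (n : ℕ) {x : TensorAlgebra K V}
    (hx : x ∈ LinearMap.range (TensorAlgebra.ι K : V →ₗ[K] TensorAlgebra K V) ^ n)
    (h : quantumSymmetrizer c n x = 0) : x ∈ radical b c := by
  induction n generalizing x with
  | zero =>
    rw [show x = 0 from h]
    exact zero_mem _
  | succ n ih =>
    rw [mem_radical_iff]
    constructor
    · rw [pow_succ'] at hx
      clear h
      induction hx using Submodule.mul_induction_on' with
      | mem_mul_mem v hv y hy =>
        obtain ⟨v, rfl⟩ := hv
        rw [map_mul, algebraMapInv_ι, zero_mul]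
      | add x _ y _ hx hy => rw [map_add, hx, hy, add_zero]
    · intro i
      exact ih (hc.skewDer_mem_pow n i hx) ((quantumSymmetrizer_succ_eq_zero_iff n x).1 h i)

variable [Fintype ι] (hσ : ∀ i j, σ (σ i j) = σ i * σ j * (σ i)⁻¹)

include hσ

theorem twistEntry_mem_radical {x : TensorAlgebra K V} (hx : x ∈ radical b c) (i j : ι) :
    twistEntry b σ i j x ∈ radical b c := by
  -- On constant terms, only the empty word counts, whose twist is the identity matrix.
  have aug : ∀ i x, TensorAlgebra.algebraMapInv (twistEntry b σ i j x) =
      (if i = j then (1 : K) else 0) * TensorAlgebra.algebraMapInv x := by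
    intro i x
    let S : Submodule K (TensorAlgebra K V) :=
      LinearMap.eqLocus (TensorAlgebra.algebraMapInv.toLinearMap ∘ₗ twistEntry b σ i j)
        ((if i = j then (1 : K) else 0) • TensorAlgebra.algebraMapInv.toLinearMap)
    refine TensorAlgebra.mem_of_ι_mul_mem b S ?_ ?_ x
    · simp only [S, LinearMap.mem_eqLocus, LinearMap.comp_apply, twistEntry_one]
      split_ifs <;> simp
    · intro k x _
      rw [LinearMap.mem_eqLocus, LinearMap.comp_apply, twistEntry_ι_mul,
        LinearMap.smul_apply]
      simp [algebraMapInv_ι]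
  rw [mem_radical]
  intro w
  induction w generalizing x i with
  | nil =>
    have h := (mem_radical_iff.1 hx).1
    simp [wordPairing, aug, h]
  | cons k w ih =>
    rw [wordPairing, LinearMap.comp_apply, hc.skewDer_twistEntry hσ]
    exact ih ((mem_radical_iff.1 hx).2 k) _

theorem mul_ι_mem_radical {x : TensorAlgebra K V} (hx : x ∈ radical b c) (j : ι) :
    x * TensorAlgebra.ι K (b j) ∈ radical b c := by
  rw [mem_radical]
  intro w
  induction w generalizing x with
  | nil => simp [wordPairing, algebraMapInv_ι]
  | cons i w ih =>
    rw [wordPairing, LinearMap.comp_apply, hc.skewDer_mul_ι, map_add,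
      ih ((mem_radical_iff.1 hx).2 i), zero_add]
    exact mem_radical.1 (hc.twistEntry_mem_radical hσ hx i j) w

theorem mul_mem_radical_right {x : TensorAlgebra K V} (hx : x ∈ radical b c)
    (y : TensorAlgebra K V) : x * y ∈ radical b c := by
  let S : Submodule K (TensorAlgebra K V) :=
    ⨅ z : radical b c, (radical b c).comap (LinearMap.mulLeft K z.1)
  have hS : ∀ y, y ∈ S ↔ ∀ z ∈ radical b c, z * y ∈ radical b c := by
    intro y
    simp [S, Submodule.mem_iInf]
  refine (hS y).1 (TensorAlgebra.mem_of_ι_mul_mem b S ?_ ?_ y) x hx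
  · rw [hS]; intro z hz; rwa [mul_one]
  · intro i y hy
    rw [hS] at hy ⊢
    intro z hz
    rw [← mul_assoc]
    exact hy _ (hc.mul_ι_mem_radical hσ hz i)

/-- The defining ideal of the Nichols algebra is contained in the radical. -/
theorem mem_radical_of_mkAlgHom_eq_zero {x : TensorAlgebra K V}
    (hx : RingQuot.mkAlgHom K (NicholsRel c) x = 0) : x ∈ radical b c := by
  -- The quotient of `T(V)` by the radical is a left module over the Nichols algebra.
  let J : Ideal (TensorAlgebra K V) :=
    { (radical b c).toAddSubmonoid with
      smul_mem' := fun y _ hx => hc.mul_mem_radical_left y hx }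
  let f : NicholsAlgebra c →ₐ[K] Module.End K (TensorAlgebra K V ⧸ J) :=
    RingQuot.liftAlgHom K ⟨Algebra.lsmul K K (TensorAlgebra K V ⧸ J), by
      rintro y _ ⟨n, _, hy, h⟩
      refine LinearMap.ext fun z => ?_
      obtain ⟨z, rfl⟩ := Submodule.Quotient.mk_surjective _ z
      rw [map_zero]
      change y • (Submodule.Quotient.mk z : TensorAlgebra K V ⧸ J) = 0
      rw [← Submodule.Quotient.mk_smul, Submodule.Quotient.mk_eq_zero]
      exact hc.mul_mem_radical_right hσ (hc.mem_radical_of_quantumSymmetrizer n hy h) z⟩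
  have h : f (RingQuot.mkAlgHom K (NicholsRel c) x) (Submodule.Quotient.mk 1) = 0 := by
    rw [hx, map_zero, LinearMap.zero_apply]
  simp only [f, RingQuot.liftAlgHom_mkAlgHom_apply] at h
  change x • (Submodule.Quotient.mk 1 : TensorAlgebra K V ⧸ J) = 0 at h
  rw [← Submodule.Quotient.mk_smul, Submodule.Quotient.mk_eq_zero, smul_eq_mul,
    mul_one] at h
  exact h

end IsRackBraiding

end NicholsKernel

/-! ### The pairing of words -/

section WordPairing

variable {ι : Type*} [DecidableEq ι]

/-- The words, with multiplicities, which occur in `∂ᵢ` of a word. -/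
def wordDer (σ : ι → Equiv.Perm ι) : ι → List ι → List (List ι)
  | _, [] => []
  | i, j :: w => (if j = i then [w] else []) ++ (wordDer σ ((σ j)⁻¹ i) w).map (j :: ·)

/-- The pairing of two words, as a natural number. -/
def wordCount (σ : ι → Equiv.Perm ι) : List ι → List ι → ℕ
  | [], [] => 1
  | [], _ :: _ => 0
  | i :: w, u => ((wordDer σ i u).map (wordCount σ w)).sum

variable {K V : Type*} [Field K] [AddCommGroup V] [Module K V]
  {b : Module.Basis ι K V} {σ : ι → Equiv.Perm ι} {c : V ⊗[K] V →ₗ[K] V ⊗[K] V}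
  (hc : IsRackBraiding b σ c)

include hc

theorem IsRackBraiding.skewDer_word (i : ι) (u : List ι) :
    skewDer b c i (u.map fun j => TensorAlgebra.ι K (b j)).prod =
      ((wordDer σ i u).map fun w => (w.map fun j => TensorAlgebra.ι K (b j)).prod).sum := by
  induction u generalizing i with
  | nil => simp [wordDer, skewDer_one]
  | cons j u ih =>
    have h : ∀ L : List (List ι), TensorAlgebra.ι K (b j) *
        (L.map fun w => (w.map fun j => TensorAlgebra.ι K (b j)).prod).sum =
        ((L.map (j :: ·)).map fun w => (w.map fun j => TensorAlgebra.ι K (b j)).prod).sum := by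
      intro L
      rw [← List.sum_map_mul_left, List.map_map]
      simp [Function.comp_def]
    rw [List.map_cons, List.prod_cons, hc.skewDer_ι_mul, ih, h, wordDer, List.map_append,
      List.sum_append]
    split_ifs <;> simp

theorem IsRackBraiding.wordPairing_word (w u : List ι) :
    wordPairing b c w (u.map fun j => TensorAlgebra.ι K (b j)).prod = (wordCount σ w u : K) := by
  induction w generalizing u with
  | nil => cases u <;> simp [wordPairing, wordCount, algebraMapInv_ι]
  | cons i w ih =>
    rw [wordPairing, LinearMap.comp_apply, hc.skewDer_word, map_list_sum, List.map_map, wordCount,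
      Nat.cast_list_sum, List.map_map]
    simp only [Function.comp_def, ih]

end WordPairing

/-- The `36` basis monomials, as words. -/
def tetraWord : Fin 36 → List (Fin 4) :=
  ![[],
    [0], [1], [2], [3],
    [0, 1], [0, 2], [0, 3], [1, 0], [1, 2], [1, 3], [2, 1], [2, 3],
    [0, 1, 0], [0, 1, 2], [0, 1, 3], [0, 2, 1], [0, 2, 3],
    [1, 0, 2], [1, 0, 3], [1, 2, 1], [1, 2, 3], [2, 1, 3],
    [0, 1, 0, 2], [0, 1, 0, 3], [0, 1, 2, 1], [0, 1, 2, 3],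
    [0, 2, 1, 3], [1, 0, 2, 1], [1, 0, 2, 3], [1, 2, 1, 3],
    [0, 1, 0, 2, 1], [0, 1, 0, 2, 3], [0, 1, 2, 1, 3], [1, 0, 2, 1, 3],
    [0, 1, 0, 2, 1, 3]]

/-- Words whose pairing with the basis monomials is unitriangular modulo `2`. -/
def tetraDualWord : Fin 36 → List (Fin 4) :=
  ![[],
    [0], [1], [2], [3],
    [0, 1], [0, 2], [0, 3], [3, 1], [1, 2], [1, 3], [3, 2], [2, 3],
    [0, 1, 0], [0, 1, 2], [0, 1, 3], [0, 3, 2], [0, 2, 3],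
    [2, 3, 1], [1, 0, 3], [1, 2, 1], [1, 2, 3], [2, 1, 3],
    [0, 1, 0, 2], [0, 1, 0, 3], [0, 1, 2, 1], [0, 1, 2, 3],
    [0, 2, 1, 3], [1, 0, 3, 2], [2, 1, 0, 3], [1, 2, 1, 3],
    [0, 1, 0, 2, 1], [0, 1, 0, 2, 3], [0, 1, 2, 1, 3], [1, 0, 2, 1, 3],
    [0, 1, 0, 2, 1, 3]]

theorem wordCount_tetraDualWord : ∀ k l : Fin 36, l ≤ k →
    wordCount tetraPerm (tetraDualWord k) (tetraWord l) % 2 = if l = k then 1 else 0 := by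
  decide +kernel

theorem tetraMonomials_eq_prod (K : Type*) [Field K] (k : Fin 36) :
    tetraMonomials K k = ((tetraWord k).map (tetraGen K)).prod := by
  fin_cases k <;> simp [tetraMonomials, tetraWord, mul_assoc]

/-! ### The Nichols algebra of the braiding of the tetrahedron rack -/

noncomputable section TetraNichols

variable {K V : Type*} [Field K] [AddCommGroup V] [Module K V]
  {b : Module.Basis (Fin 4) K V} {c : V ⊗[K] V →ₗ[K] V ⊗[K] V} (hc : IsRackBraiding b tetraPerm c)

theorem tetraPerm_tetraPerm : ∀ i j : Fin 4,
    tetraPerm (tetraPerm i j) = tetraPerm i * tetraPerm j * (tetraPerm i)⁻¹ := by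
  decide

theorem tetraPerm_apply (i j : Fin 4) : tetraPerm i j =
    ![![0, 2, 3, 1], ![3, 1, 0, 2], ![1, 3, 2, 0], ![2, 0, 1, 3]] i j := by
  revert i j; decide

/-- A homogeneous element of degree `n + 1` vanishes in the Nichols algebra if its skew derivatives
are in the kernel of the quantum symmetrizer. -/
theorem mkAlgHom_eq_zero {ι : Type*} [Fintype ι] [DecidableEq ι] (b : Module.Basis ι K V)
    (n : ℕ) {x : TensorAlgebra K V}
    (hx : x ∈ LinearMap.range (TensorAlgebra.ι K : V →ₗ[K] TensorAlgebra K V) ^ (n + 1))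
    (h : ∀ i, quantumSymmetrizer c n (skewDer b c i x) = 0) :
    RingQuot.mkAlgHom K (NicholsRel c) x = 0 := by
  rw [← map_zero (RingQuot.mkAlgHom K (NicholsRel c))]
  exact RingQuot.mkAlgHom_rel K
    (NicholsRel.ker (n + 1) x hx ((quantumSymmetrizer_succ_eq_zero_iff n x).2 h))

include hc

namespace IsRackBraiding

theorem skewDer_ι_mul_ι (i j k : Fin 4) :
    skewDer b c i (TensorAlgebra.ι K (b j) * TensorAlgebra.ι K (b k)) =
      (if j = i then TensorAlgebra.ι K (b k) else 0) +
        if tetraPerm j k = i then TensorAlgebra.ι K (b j) else 0 := by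
  have h := hc.skewDer_ι_mul ((tetraPerm j)⁻¹ i) k 1
  rw [mul_one, skewDer_one, mul_zero, add_zero] at h
  rw [hc.skewDer_ι_mul, h]
  simp only [Equiv.Perm.eq_inv_iff_eq]
  split_ifs <;> simp

theorem skewDer_ι_mul_ι_mul_ι (i j k l : Fin 4) :
    skewDer b c i (TensorAlgebra.ι K (b j) * TensorAlgebra.ι K (b k) * TensorAlgebra.ι K (b l)) =
      (if j = i then TensorAlgebra.ι K (b k) * TensorAlgebra.ι K (b l) else 0) +
      ((if tetraPerm j k = i then TensorAlgebra.ι K (b j) * TensorAlgebra.ι K (b l) else 0) +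
        if tetraPerm j (tetraPerm k l) = i then
          TensorAlgebra.ι K (b j) * TensorAlgebra.ι K (b k) else 0) := by
  rw [mul_assoc, hc.skewDer_ι_mul, hc.skewDer_ι_mul_ι]
  simp only [Equiv.Perm.eq_inv_iff_eq, mul_add, mul_ite, mul_zero]

variable [CharP K 2]

theorem skewDer_sq (i j : Fin 4) :
    skewDer b c i (TensorAlgebra.ι K (b j) * TensorAlgebra.ι K (b j)) = 0 := by
  have h : tetraPerm j j = j := by revert j; decide
  rw [hc.skewDer_ι_mul_ι, h, ← two_smul K, CharTwo.two_eq_zero, zero_smul]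

/-- The quadratic relations are primitive, as the braiding permutes their terms cyclically. -/
theorem skewDer_quad {j k l : Fin 4} (h₁ : tetraPerm j k = l) (h₂ : tetraPerm l j = k)
    (h₃ : tetraPerm k l = j) (i : Fin 4) :
    skewDer b c i (TensorAlgebra.ι K (b j) * TensorAlgebra.ι K (b k) +
      TensorAlgebra.ι K (b l) * TensorAlgebra.ι K (b j) +
      TensorAlgebra.ι K (b k) * TensorAlgebra.ι K (b l)) = 0 := by
  have h (x : TensorAlgebra K V) : x + x = 0 := by
    rw [← two_smul K, CharTwo.two_eq_zero, zero_smul]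
  simp only [map_add, hc.skewDer_ι_mul_ι, h₁, h₂, h₃]
  have key (p q r : TensorAlgebra K V) : p + q + (q + r) + (r + p) = 0 := by
    rw [show p + q + (q + r) + (r + p) = p + p + (q + q) + (r + r) by abel, h, h, h, zero_add, h]
  exact key _ _ _

/-- The skew derivatives of the cubic relation are quadratic relations. -/
theorem skewDer_cubic (i : Fin 4) :
    quantumSymmetrizer c 2 (skewDer b c i
      (TensorAlgebra.ι K (b 2) * TensorAlgebra.ι K (b 0) * TensorAlgebra.ι K (b 3) +
        TensorAlgebra.ι K (b 1) * TensorAlgebra.ι K (b 0) * TensorAlgebra.ι K (b 2) +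
        TensorAlgebra.ι K (b 3) * TensorAlgebra.ι K (b 0) * TensorAlgebra.ι K (b 1))) = 0 := by
  have h {j k l : Fin 4} (h₁ : tetraPerm j k = l) (h₂ : tetraPerm l j = k)
      (h₃ : tetraPerm k l = j) : quantumSymmetrizer c 2
        (TensorAlgebra.ι K (b j) * TensorAlgebra.ι K (b k)) +
        quantumSymmetrizer c 2 (TensorAlgebra.ι K (b l) * TensorAlgebra.ι K (b j)) +
        quantumSymmetrizer c 2 (TensorAlgebra.ι K (b k) * TensorAlgebra.ι K (b l)) = 0 := by
    rw [← map_add, ← map_add, quantumSymmetrizer_succ_eq_zero_iff (b := b)]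
    intro i
    rw [hc.skewDer_quad h₁ h₂ h₃, map_zero]
  have h1 := h (j := 1) (k := 0) (l := 3) (by decide) (by decide) (by decide)
  have h2 := h (j := 2) (k := 0) (l := 1) (by decide) (by decide) (by decide)
  have h3 := h (j := 3) (k := 0) (l := 2) (by decide) (by decide) (by decide)
  simp only [map_add, hc.skewDer_ι_mul_ι_mul_ι, tetraPerm_apply]
  fin_cases i <;> simp
  · rw [← h3]; abel
  · rw [← h1]; abel
  · rw [← h2]

/-- The defining relations of `TetraAlgebra` hold in the Nichols algebra. -/
theorem lift_rel {x y : FreeAlgebra K (Fin 4)} (h : TetraRel K x y) :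
    FreeAlgebra.lift K (fun i => NicholsAlgebra.ι c (b i)) x =
      FreeAlgebra.lift K (fun i => NicholsAlgebra.ι c (b i)) y := by
  have hR (i : Fin 4) : TensorAlgebra.ι K (b i) ∈
      LinearMap.range (TensorAlgebra.ι K : V →ₗ[K] TensorAlgebra K V) :=
    LinearMap.mem_range_self _ _
  have h2 (i j : Fin 4) : TensorAlgebra.ι K (b i) * TensorAlgebra.ι K (b j) ∈
      LinearMap.range (TensorAlgebra.ι K : V →ₗ[K] TensorAlgebra K V) ^ 2 := by
    rw [pow_two]; exact Submodule.mul_mem_mul (hR i) (hR j)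
  have h3 (i j k : Fin 4) :
      TensorAlgebra.ι K (b i) * TensorAlgebra.ι K (b j) * TensorAlgebra.ι K (b k) ∈
        LinearMap.range (TensorAlgebra.ι K : V →ₗ[K] TensorAlgebra K V) ^ 3 := by
    rw [pow_succ]; exact Submodule.mul_mem_mul (h2 i j) (hR k)
  have hq {j k l : Fin 4} (h₁ : tetraPerm j k = l) (h₂ : tetraPerm l j = k)
      (h₃ : tetraPerm k l = j) := mkAlgHom_eq_zero b 1 (c := c)
        (add_mem (add_mem (h2 j k) (h2 l j)) (h2 k l))
        fun i => by rw [hc.skewDer_quad h₁ h₂ h₃, map_zero]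
  cases h with
  | sq i =>
    have := mkAlgHom_eq_zero b 1 (c := c) (h2 i i) fun k => by rw [hc.skewDer_sq, map_zero]
    simpa [NicholsAlgebra.ι] using this
  | quad₁ =>
    simpa [NicholsAlgebra.ι] using
      hq (j := 1) (k := 0) (l := 3) (by decide) (by decide) (by decide)
  | quad₂ =>
    simpa [NicholsAlgebra.ι] using
      hq (j := 2) (k := 0) (l := 1) (by decide) (by decide) (by decide)
  | quad₃ =>
    simpa [NicholsAlgebra.ι] using
      hq (j := 3) (k := 0) (l := 2) (by decide) (by decide) (by decide)
  | quad₄ =>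
    simpa [NicholsAlgebra.ι] using
      hq (j := 2) (k := 1) (l := 3) (by decide) (by decide) (by decide)
  | cubic =>
    simpa [NicholsAlgebra.ι] using
      mkAlgHom_eq_zero b 2 (c := c) (add_mem (add_mem (h3 2 0 3) (h3 1 0 2)) (h3 3 0 1))
        hc.skewDer_cubic

/-- The algebra map from `TetraAlgebra` to the Nichols algebra. -/
def toNichols : TetraAlgebra K →ₐ[K] NicholsAlgebra c :=
  RingQuot.liftAlgHom K
    ⟨FreeAlgebra.lift K fun i => NicholsAlgebra.ι c (b i), fun _ _ h => hc.lift_rel h⟩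

theorem toNichols_gen (i : Fin 4) : hc.toNichols (tetraGen K i) = NicholsAlgebra.ι c (b i) := by
  simp [toNichols, tetraGen]

/-- The `36` monomials are linearly independent in the Nichols algebra: a relation between them
lies in the radical, and the matrix of their pairings with `tetraDualWord` is unitriangular. -/
theorem linearIndependent_tetraWord : LinearIndependent K fun k : Fin 36 =>
    ((tetraWord k).map fun i => NicholsAlgebra.ι c (b i)).prod := by
  rw [Fintype.linearIndependent_iff]
  intro g hg
  let m : Fin 36 → TensorAlgebra K V := fun k =>
    ((tetraWord k).map fun i => TensorAlgebra.ι K (b i)).prod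
  have hm : ∀ k, RingQuot.mkAlgHom K (NicholsRel c) (m k) =
      ((tetraWord k).map fun i => NicholsAlgebra.ι c (b i)).prod := by
    intro k
    rw [map_list_prod, List.map_map]
    rfl
  have hrad : ∑ k, g k • m k ∈ radical b c := by
    refine hc.mem_radical_of_mkAlgHom_eq_zero tetraPerm_tetraPerm ?_
    rw [map_sum, ← hg]
    exact Finset.sum_congr rfl fun k _ => by rw [map_smul, hm]
  let A : Matrix (Fin 36) (Fin 36) K := Matrix.of fun k l =>
    (wordCount tetraPerm (tetraDualWord k) (tetraWord l) : K)
  have hA : ∀ k l, l ≤ k → A k l = if l = k then 1 else 0 := by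
    intro k l hkl
    have h := wordCount_tetraDualWord k l hkl
    change (wordCount tetraPerm (tetraDualWord k) (tetraWord l) : K) = _
    rw [← Nat.mod_add_div (wordCount tetraPerm (tetraDualWord k) (tetraWord l)) 2, h]
    push_cast
    rw [CharTwo.two_eq_zero, zero_mul, add_zero]
  have hdet : A.det = 1 := by
    rw [Matrix.det_of_isUpperTriangular]
    · exact Finset.prod_eq_one fun k _ => by rw [hA k k le_rfl, if_pos rfl]
    · intro k l (hkl : l < k)
      rw [hA k l hkl.le, if_neg hkl.ne]
  have hAg : A.mulVec g = 0 := by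
    funext k
    have h := mem_radical.1 hrad (tetraDualWord k)
    rw [map_sum] at h
    rw [Pi.zero_apply, ← h, Matrix.mulVec, dotProduct]
    refine Finset.sum_congr rfl fun l _ => ?_
    rw [map_smul, hc.wordPairing_word, smul_eq_mul, mul_comm]
    rfl
  exact congrFun (Matrix.eq_zero_of_mulVec_eq_zero (by rw [hdet]; exact one_ne_zero) hAg)

theorem toNichols_tetraMonomials (k : Fin 36) : hc.toNichols (tetraMonomials K k) =
    ((tetraWord k).map fun i => NicholsAlgebra.ι c (b i)).prod := by
  rw [tetraMonomials_eq_prod, map_list_prod, List.map_map]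
  simp only [Function.comp_def, hc.toNichols_gen]

/-- The `36` monomials form a basis of `TetraAlgebra`, as their images in the Nichols algebra are
linearly independent. -/
def tetraBasis : Module.Basis (Fin 36) K (TetraAlgebra K) :=
  Module.Basis.mk
    (LinearIndependent.of_comp hc.toNichols.toLinearMap (v := tetraMonomials K) (by
      rw [show hc.toNichols.toLinearMap ∘ tetraMonomials K = _ from
        funext hc.toNichols_tetraMonomials]
      exact hc.linearIndependent_tetraWord))
    (TetraAlgebra.span_tetraMonomials K).ge

theorem coe_tetraBasis : ⇑hc.tetraBasis = tetraMonomials K :=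
  Module.Basis.coe_mk _ _

theorem toNichols_bijective : Function.Bijective hc.toNichols := by
  constructor
  · rw [injective_iff_map_eq_zero]
    intro x hx
    rw [← hc.tetraBasis.sum_repr x, map_sum] at hx
    have h := Fintype.linearIndependent_iff.1 hc.linearIndependent_tetraWord
      (hc.tetraBasis.repr x) (by
        rw [← hx]
        refine Finset.sum_congr rfl fun k _ => ?_
        rw [map_smul, coe_tetraBasis, toNichols_tetraMonomials])
    rw [← hc.tetraBasis.sum_repr x]
    exact Finset.sum_eq_zero fun k _ => by rw [h, zero_smul]
  · intro y
    obtain ⟨x, rfl⟩ := RingQuot.mkAlgHom_surjective K (NicholsRel c) y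
    change RingQuot.mkAlgHom K (NicholsRel c) x ∈ hc.toNichols.range
    let S : Submodule K (TensorAlgebra K V) := (Subalgebra.toSubmodule hc.toNichols.range).comap
      (RingQuot.mkAlgHom K (NicholsRel c)).toLinearMap
    refine TensorAlgebra.mem_of_ι_mul_mem b S ?_ ?_ x
    · change RingQuot.mkAlgHom K (NicholsRel c) 1 ∈ hc.toNichols.range
      rw [map_one]; exact one_mem _
    · intro i z hz
      change RingQuot.mkAlgHom K (NicholsRel c) (TensorAlgebra.ι K (b i) * z) ∈ hc.toNichols.range
      rw [map_mul]
      exact mul_mem ⟨tetraGen K i, hc.toNichols_gen i⟩ hz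

/-- The Nichols algebra of a braided vector space with a basis which is permuted by the braiding
like the rack of the tetrahedron. -/
theorem existsUnique_algEquiv :
    (∃! φ : NicholsAlgebra c ≃ₐ[K] TetraAlgebra K,
      ∀ i, φ (NicholsAlgebra.ι c (b i)) = tetraGen K i) ∧
    Module.finrank K (NicholsAlgebra c) = 36 := by
  let e : TetraAlgebra K ≃ₐ[K] NicholsAlgebra c :=
    AlgEquiv.ofBijective hc.toNichols hc.toNichols_bijective
  have he (i : Fin 4) : e (tetraGen K i) = NicholsAlgebra.ι c (b i) := hc.toNichols_gen i
  refine ⟨⟨e.symm, fun i => by rw [← he, e.symm_apply_apply], fun φ hφ => ?_⟩, ?_⟩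
  · have h : φ.toAlgHom.comp e.toAlgHom = AlgHom.id K (TetraAlgebra K) := by
      refine RingQuot.ringQuot_ext' K _ _ (FreeAlgebra.hom_ext (funext fun i => ?_))
      change φ (e (tetraGen K i)) = tetraGen K i
      rw [he, hφ]
    ext x
    have := AlgHom.congr_fun h (e.symm x)
    change φ (e (e.symm x)) = e.symm x at this
    rwa [e.apply_symm_apply] at this
  · rw [← e.toLinearEquiv.finrank_eq, Module.finrank_eq_card_basis hc.tetraBasis, Fintype.card_fin]

end IsRackBraiding

end TetraNichols

/-- The `36` monomials form a basis of `TetraAlgebra`. -/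
theorem exists_basis_tetraMonomials (K : Type*) [Field K] [CharP K 2] :
    ∃ B : Module.Basis (Fin 36) K (TetraAlgebra K), ⇑B = tetraMonomials K := by
  let b := Pi.basisFun K (Fin 4)
  let c : (Fin 4 → K) ⊗[K] (Fin 4 → K) →ₗ[K] (Fin 4 → K) ⊗[K] (Fin 4 → K) :=
    (b.tensorProduct b).constr K fun p => b (tetraPerm p.1 p.2) ⊗ₜ b p.1
  have hc : IsRackBraiding b tetraPerm c := fun i j => by
    rw [← Module.Basis.tensorProduct_apply, Module.Basis.constr_basis]
  exact ⟨hc.tetraBasis, hc.coe_tetraBasis⟩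

/-! ### The centralizer of `x₁` in the enveloping group -/

section TetraGroup

/-- The elements `1, x₃, x₄, x₂`, which conjugate `x₁` to `x₁, x₂, x₃, x₄`. -/
def tetraTransversal : Fin 4 → TetraGroup :=
  ![1, tetraX 2, tetraX 3, tetraX 1]

theorem tetraTransversal_mul (j : Fin 4) :
    tetraTransversal j * tetraX 0 = tetraX j * tetraTransversal j := by
  fin_cases j
  · exact (one_mul _).trans (mul_one _).symm
  · exact tetraX_mul 2 0
  · exact tetraX_mul 3 0
  · exact tetraX_mul 1 0

theorem tetraX_injective : Function.Injective tetraX := by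
  intro i j h
  have key (i k : Fin 4) :
      (Rack.envelAction (tetraX i) : TetraRack ≃ TetraRack) k = tetraPerm i k :=
    Rack.envelAction_prop (R := TetraRack) i k
  refine tetraPerm_injective (Equiv.ext fun k => ?_)
  rw [← key, ← key, h]

/-- The subgroup generated by `x₁` and `x₂ x₄`. -/
def tetraCentralizer : Subgroup TetraGroup :=
  Subgroup.closure {tetraX 0, tetraX 1 * tetraX 3}

theorem tetraX_mul_eq_mul {i j k : Fin 4} (h : tetraPerm i j = k) :
    tetraX i * tetraX j = tetraX k * tetraX i := by
  rw [tetraX_mul, h]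

/-- The generators permute the left cosets of `tetraCentralizer` of the elements of the
transversal. -/
theorem tetraX_mul_tetraTransversal (i j : Fin 4) :
    ∃ h ∈ tetraCentralizer,
      tetraX i * tetraTransversal j = tetraTransversal (tetraPerm i j) * h := by
  have mx : tetraX 0 ∈ tetraCentralizer := Subgroup.subset_closure (by simp)
  have mz : tetraX 1 * tetraX 3 ∈ tetraCentralizer := Subgroup.subset_closure (by simp)
  -- `xₖ xₖ x₁ = xₘ (x₂ x₄)` for suitable `m`.
  have sq {k l m : Fin 4} (h₁ : tetraPerm k 0 = m) (h₂ : tetraX k * tetraX m = tetraX 1 * tetraX 3)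
      (h₃ : tetraX l * tetraX k = tetraX 1 * tetraX 3)
      (h₄ : tetraX m * tetraX l = tetraX 1 * tetraX 3) :
      tetraX k * tetraX k = tetraX m * (tetraX 1 * tetraX 3 * (tetraX 0)⁻¹) := by
    rw [← mul_assoc, eq_mul_inv_iff_mul_eq, mul_assoc, tetraX_mul_eq_mul h₁, ← mul_assoc, h₂, ← h₄,
      mul_assoc, h₃, h₄]
  have mzx := mul_mem mz (inv_mem mx)
  have z₁ := tetraX_mul_eq.1
  have z₂ := tetraX_mul_eq.1.trans tetraX_mul_eq.2
  rw [tetraPerm_apply]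
  fin_cases i <;> fin_cases j
  · exact ⟨_, mx, (mul_one _).trans (one_mul _).symm⟩
  · exact ⟨_, mx, tetraX_mul_eq_mul (by decide)⟩
  · exact ⟨_, mx, tetraX_mul_eq_mul (by decide)⟩
  · exact ⟨_, mx, tetraX_mul_eq_mul (by decide)⟩
  · exact ⟨1, one_mem _, rfl⟩
  · exact ⟨_, mx, (tetraX_mul_eq_mul (k := 0) (by decide)).trans
      (tetraX_mul_eq_mul (k := 2) (by decide))⟩
  · exact ⟨_, mz, (one_mul _).symm⟩
  · exact ⟨_, mzx, sq (l := 2) (by decide) rfl z₁.symm z₂.symm⟩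
  · exact ⟨1, one_mem _, rfl⟩
  · exact ⟨_, mzx, sq (l := 3) (by decide) z₁.symm z₂.symm rfl⟩
  · exact ⟨_, mx, (tetraX_mul_eq_mul (k := 0) (by decide)).trans
      (tetraX_mul_eq_mul (k := 3) (by decide))⟩
  · exact ⟨_, mz, z₁.symm.trans (one_mul _).symm⟩
  · exact ⟨1, one_mem _, rfl⟩
  · exact ⟨_, mz, z₂.symm.trans (one_mul _).symm⟩
  · exact ⟨_, mzx, sq (l := 1) (by decide) z₂.symm rfl z₁.symm⟩
  · exact ⟨_, mx, (tetraX_mul_eq_mul (k := 0) (by decide)).trans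
      (tetraX_mul_eq_mul (k := 1) (by decide))⟩

theorem exists_perm_mul_tetraTransversal (g : TetraGroup) :
    ∃ π : Equiv.Perm (Fin 4), ∀ j, ∃ h ∈ tetraCentralizer,
      g * tetraTransversal j = tetraTransversal (π j) * h := by
  have one : ∃ π : Equiv.Perm (Fin 4), ∀ j, ∃ h ∈ tetraCentralizer,
      1 * tetraTransversal j = tetraTransversal (π j) * h :=
    ⟨1, fun j => ⟨1, one_mem _, by simp⟩⟩
  have mul {g g' : TetraGroup} (hg : ∃ π : Equiv.Perm (Fin 4), ∀ j, ∃ h ∈ tetraCentralizer,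
        g * tetraTransversal j = tetraTransversal (π j) * h)
      (hg' : ∃ π : Equiv.Perm (Fin 4), ∀ j, ∃ h ∈ tetraCentralizer,
        g' * tetraTransversal j = tetraTransversal (π j) * h) :
      ∃ π : Equiv.Perm (Fin 4), ∀ j, ∃ h ∈ tetraCentralizer,
        g * g' * tetraTransversal j = tetraTransversal (π j) * h := by
    obtain ⟨π, hπ⟩ := hg
    obtain ⟨π', hπ'⟩ := hg'
    refine ⟨π * π', fun j => ?_⟩
    obtain ⟨h', hh', e'⟩ := hπ' j
    obtain ⟨h, hh, e⟩ := hπ (π' j)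
    exact ⟨h * h', mul_mem hh hh', by rw [mul_assoc, e', ← mul_assoc, e, mul_assoc]; rfl⟩
  have inv {g : TetraGroup} (hg : ∃ π : Equiv.Perm (Fin 4), ∀ j, ∃ h ∈ tetraCentralizer,
        g * tetraTransversal j = tetraTransversal (π j) * h) :
      ∃ π : Equiv.Perm (Fin 4), ∀ j, ∃ h ∈ tetraCentralizer,
        g⁻¹ * tetraTransversal j = tetraTransversal (π j) * h := by
    obtain ⟨π, hπ⟩ := hg
    refine ⟨π⁻¹, fun j => ?_⟩
    obtain ⟨h, hh, e⟩ := hπ (π⁻¹ j)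
    rw [show π (π⁻¹ j) = j from π.apply_symm_apply j] at e
    exact ⟨h⁻¹, inv_mem hh, by rw [inv_mul_eq_iff_eq_mul, ← mul_assoc, e, mul_inv_cancel_right]⟩
  induction g using Quotient.inductionOn with
  | h g =>
    induction g with
    | unit => exact one
    | incl i => exact ⟨tetraPerm i, tetraX_mul_tetraTransversal i⟩
    | mul g g' hg hg' => exact mul hg hg'
    | inv g hg => exact inv hg

theorem tetraCentralizer_le : tetraCentralizer ≤ Subgroup.centralizer {tetraX 0} := by
  rw [tetraCentralizer, Subgroup.closure_le]
  rintro _ (rfl | rfl)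
  exacts [tetraX_self_mem, tetraX_mul_mem]

theorem centralizer_tetraX_zero : Subgroup.centralizer {tetraX 0} = tetraCentralizer := by
  refine le_antisymm (fun g hg => ?_) tetraCentralizer_le
  obtain ⟨π, hπ⟩ := exists_perm_mul_tetraTransversal g
  obtain ⟨h, hh, e⟩ := hπ 0
  rw [show tetraTransversal 0 = 1 from rfl, mul_one] at e
  have ht : tetraTransversal (π 0) ∈ Subgroup.centralizer {tetraX 0} := by
    rw [eq_mul_inv_of_mul_eq e.symm]
    exact mul_mem hg (inv_mem (tetraCentralizer_le hh))
  rw [Subgroup.mem_centralizer_singleton_iff] at ht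
  have h0 : π 0 = 0 := by
    have := tetraTransversal_mul (π 0)
    rw [ht, mul_left_inj] at this
    exact (tetraX_injective this).symm
  rw [e, h0, show tetraTransversal 0 = 1 from rfl, one_mul]
  exact hh

end TetraGroup

/-! ### The Yetter-Drinfeld module -/

noncomputable section

namespace YDModule

variable {K G V : Type*} [Field K] [Group G] [AddCommGroup V] [Module K V] (M : YDModule K G V)

/-- The projection of a Yetter-Drinfeld module onto its component of degree `g`. -/
def proj (g : G) : V →ₗ[K] V :=
  (TensorProduct.lid K V).toLinearMap ∘ₗ
    (Finsupp.lapply g ∘ₗ (MonoidAlgebra.coeffLinearEquiv K).toLinearMap).rTensor V ∘ₗ M.coaction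

variable {M}

theorem proj_of_mem {g : G} {v : V} (hv : v ∈ M.component g) : M.proj g v = v := by
  rw [mem_component] at hv
  simp [proj, hv]

theorem proj_of_mem_ne {g h : G} {v : V} (hv : v ∈ M.component g) (hgh : g ≠ h) :
    M.proj h v = 0 := by
  rw [mem_component] at hv
  simp [proj, hv, hgh]

theorem action_mem_component {g : G} {v : V} (hv : v ∈ M.component g) (h : G) :
    M.action h v ∈ M.component (h * g * h⁻¹) := by
  rw [mem_component] at hv ⊢
  have := LinearMap.congr_fun (M.compat h) v
  simpa [hv] using this

theorem linearIndependent_of_mem_component {ι : Type*} [Fintype ι] {g : ι → G}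
    (hg : Function.Injective g) {v : ι → V} (hv : ∀ i, v i ∈ M.component (g i))
    (h0 : ∀ i, v i ≠ 0) : LinearIndependent K v := by
  rw [Fintype.linearIndependent_iff]
  intro r hr i
  have h := congrArg (M.proj (g i)) hr
  rw [map_sum, map_zero, Finset.sum_eq_single i, map_smul, proj_of_mem (hv i)] at h
  · exact (smul_eq_zero.1 h).resolve_right (h0 i)
  · intro j _ hj
    rw [map_smul, proj_of_mem_ne (hv j) (hg.ne hj), smul_zero]
  · simp

end YDModule

/-- If an absolutely simple representation is trivial, then its space has dimension at most one. -/
theorem IsAbsolutelySimple.exists_smul_eq {K : Type u} [Field K] {G W : Type*} [Group G]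
    [AddCommGroup W] [Module K W] {ρ : Representation K G W} (hs : IsAbsolutelySimple ρ)
    (hρ : ∀ g, ρ g = 1) : ∃ w : W, ∀ u : W, ∃ r : K, r • w = u := by
  by_cases hw : ∃ w : W, w ≠ 0
  · obtain ⟨w, hw⟩ := hw
    refine ⟨w, fun u => ?_⟩
    have hirr := hs K
    let S : Subrepresentation (scalarExtension K ρ) :=
      { toSubmodule := K ∙ ((1 : K) ⊗ₜ[K] w)
        apply_mem_toSubmodule := fun g x hx => by
          have : scalarExtension K ρ g = LinearMap.id := by
            change (ρ g).baseChange K = _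
            rw [hρ]
            exact LinearMap.baseChange_id
          rw [this]
          exact hx }
    rcases eq_bot_or_eq_top S with h | h
    · have h1 : (1 : K) ⊗ₜ[K] w ∈ (⊥ : Subrepresentation (scalarExtension K ρ)) :=
        h ▸ Submodule.mem_span_singleton_self _
      have h2 : (1 : K) ⊗ₜ[K] w = 0 := h1
      have := congrArg (TensorProduct.lid K W) h2
      exact absurd (by simpa using this) hw
    · have h1 : (1 : K) ⊗ₜ[K] u ∈ S := h ▸ (trivial : (1 : K) ⊗ₜ[K] u ∈ (⊤ : Submodule K _))
      obtain ⟨r, hr⟩ := Submodule.mem_span_singleton.1 (show _ ∈ K ∙ ((1 : K) ⊗ₜ[K] w) from h1)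
      exact ⟨r, by simpa using congrArg (TensorProduct.lid K W) hr⟩
  · push Not at hw
    exact ⟨0, fun u => ⟨0, by rw [hw u, smul_zero]⟩⟩

section TetraModule

variable {K : Type u} [Field K] {W : Type w} [AddCommGroup W] [Module K W]
  {ρ : Representation K (Subgroup.centralizer {tetraX 0}) W}

theorem rho_eq_one [CharP K 2] (hx : ρ ⟨tetraX 0, tetraX_self_mem⟩ = -1)
    (hz : ρ ⟨tetraX 1 * tetraX 3, tetraX_mul_mem⟩ = 1) (g) : ρ g = 1 := by
  have h : tetraCentralizer ≤ (MonoidHom.ker ρ).map (Subgroup.centralizer {tetraX 0}).subtype := by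
    rw [tetraCentralizer, Subgroup.closure_le]
    rintro _ (rfl | rfl)
    · refine ⟨⟨tetraX 0, tetraX_self_mem⟩, ?_, rfl⟩
      change ρ _ = 1
      rw [hx]
      refine LinearMap.ext fun u => ?_
      change -u = u
      rw [neg_eq_iff_add_eq_zero, ← two_smul K, CharTwo.two_eq_zero, zero_smul]
    · exact ⟨⟨tetraX 1 * tetraX 3, tetraX_mul_mem⟩, hz, rfl⟩
  obtain ⟨g', hg', e⟩ := h (centralizer_tetraX_zero.le g.2)
  rw [show g = g' from Subtype.ext e.symm]
  exact hg'

theorem indV_mk_mul (hρ : ∀ g, ρ g = 1) {z : TetraGroup} (hz : z ∈ tetraCentralizer)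
    (h : TetraGroup) (u : W) :
    Representation.IndV.mk (Subgroup.centralizer {tetraX 0}).subtype ρ (z * h) u =
      Representation.IndV.mk _ ρ h u := by
  have := Representation.Coinvariants.mk_self_apply
    (Representation.tprod ((Representation.leftRegular K TetraGroup).comp
      (Subgroup.centralizer {tetraX 0}).subtype) ρ) ⟨z, tetraCentralizer_le hz⟩
      (MonoidAlgebra.single h 1 ⊗ₜ u)
  simpa [hρ] using this

/-- The vectors `t ⊗ w`, with `t` in the transversal and `w` spanning the space of `ρ`, span the
induced module. -/
theorem span_mk_tetraTransversal (hρ : ∀ g, ρ g = 1) {w : W} (hw : ∀ u : W, ∃ r : K, r • w = u) :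
    Submodule.span K (Set.range fun j => Representation.IndV.mk
      (Subgroup.centralizer {tetraX 0}).subtype ρ (tetraTransversal j)⁻¹ w) = ⊤ := by
  set S := Submodule.span K (Set.range fun j => Representation.IndV.mk
    (Subgroup.centralizer {tetraX 0}).subtype ρ (tetraTransversal j)⁻¹ w) with hS
  rw [← S.ker_mkQ, LinearMap.ker_eq_top]
  refine Representation.IndV.hom_ext _ _ fun h => LinearMap.ext fun u => ?_
  change S.mkQ (Representation.IndV.mk _ ρ h u) = 0
  obtain ⟨π, hπ⟩ := exists_perm_mul_tetraTransversal h⁻¹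
  obtain ⟨z, hz, e⟩ := hπ 0
  obtain ⟨r, rfl⟩ := hw u
  rw [show tetraTransversal 0 = 1 from rfl, mul_one, inv_eq_iff_eq_inv, mul_inv_rev] at e
  rw [e, indV_mk_mul hρ (inv_mem hz), map_smul, map_smul, Submodule.mkQ_apply,
    (Submodule.Quotient.mk_eq_zero S).2 (Submodule.subset_span ⟨π 0, rfl⟩), smul_zero]

/-- Here `IndV.mk _ ρ h u` stands for `h⁻¹ ⊗ u`. -/
theorem mk_mem_component (h : TetraGroup) (u : W) :
    Representation.IndV.mk _ ρ h u ∈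
      (inducedYD (tetraX 0) ρ).component (h⁻¹ * tetraX 0 * h) := by
  rw [YDModule.mem_component]
  exact inducedCoaction_mk _ _ _ _

theorem tetraTransversal_conj (j : Fin 4) :
    tetraTransversal j * tetraX 0 * (tetraTransversal j)⁻¹ = tetraX j := by
  rw [tetraTransversal_mul, mul_inv_cancel_right]

/-- The centralizer of `x₁` acts trivially on the component of degree `x₁`. -/
theorem action_eq_self (hs : IsAbsolutelySimple ρ) (hρ : ∀ g, ρ g = 1)
    {v : InducedSpace (tetraX 0) ρ} (hv : v ∈ (inducedYD (tetraX 0) ρ).component (tetraX 0))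
    {h : TetraGroup} (hh : h ∈ tetraCentralizer) : (inducedYD (tetraX 0) ρ).action h v = v := by
  obtain ⟨w, hw⟩ := hs.exists_smul_eq hρ
  have hmem : v ∈ Submodule.span K (Set.range fun j => Representation.IndV.mk
      (Subgroup.centralizer {tetraX 0}).subtype ρ (tetraTransversal j)⁻¹ w) := by
    rw [span_mk_tetraTransversal hρ hw]; trivial
  obtain ⟨r, hr⟩ := (Submodule.mem_span_range_iff_exists_fun K).1 hmem
  -- Of the vectors `t ⊗ w`, only the one with `t = 1` has degree `x₁`.
  have hv0 : v = r 0 • Representation.IndV.mk _ ρ 1 w := by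
    have e := congrArg ((inducedYD (tetraX 0) ρ).proj (tetraX 0)) hr
    have hc (j : Fin 4) := mk_mem_component (ρ := ρ) (tetraTransversal j)⁻¹ w
    simp only [inv_inv, tetraTransversal_conj] at hc
    rw [YDModule.proj_of_mem hv, map_sum, Finset.sum_eq_single 0, map_smul,
      YDModule.proj_of_mem (hc 0)] at e
    · rw [← e, show tetraTransversal 0 = 1 from rfl, inv_one]
    · intro j _ hj
      rw [map_smul, YDModule.proj_of_mem_ne (hc j) (tetraX_injective.ne hj), smul_zero]
    · simp
  have hact : (inducedYD (tetraX 0) ρ).action h (Representation.IndV.mk _ ρ 1 w) =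
      Representation.IndV.mk _ ρ 1 w := by
    change Representation.ind _ ρ h (Representation.IndV.mk _ ρ 1 w) = _
    rw [Representation.ind_mk, one_mul, ← indV_mk_mul hρ (inv_mem hh) 1, mul_one]
  rw [hv0, map_smul, hact]

/-- The vectors `t v`, with `t` in the transversal, form a basis, on which the braiding is the one
of the tetrahedron rack. -/
theorem exists_basis_isRackBraiding (hs : IsAbsolutelySimple ρ) (hρ : ∀ g, ρ g = 1)
    {v : InducedSpace (tetraX 0) ρ} (hv : v ∈ (inducedYD (tetraX 0) ρ).component (tetraX 0))
    (hv0 : v ≠ 0) :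
    ∃ B : Module.Basis (Fin 4) K (InducedSpace (tetraX 0) ρ),
      (∀ j, B j = (inducedYD (tetraX 0) ρ).action (tetraTransversal j) v) ∧
      IsRackBraiding B tetraPerm (inducedYD (tetraX 0) ρ).braiding := by
  set M := inducedYD (tetraX 0) ρ
  have hmem (j : Fin 4) : M.action (tetraTransversal j) v ∈ M.component (tetraX j) := by
    rw [← tetraTransversal_conj j]
    exact M.action_mem_component hv _
  have hne (j : Fin 4) : M.action (tetraTransversal j) v ≠ 0 := by
    intro h
    have := congrArg (M.action (tetraTransversal j)⁻¹) h
    rw [map_zero, ← Module.End.mul_apply, ← map_mul, inv_mul_cancel, map_one] at this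
    exact hv0 this
  have hli : LinearIndependent K fun j => M.action (tetraTransversal j) v :=
    YDModule.linearIndependent_of_mem_component tetraX_injective hmem hne
  obtain ⟨w, hw⟩ := hs.exists_smul_eq hρ
  have hspan := span_mk_tetraTransversal hρ hw
  have hfin : Module.Finite K (InducedSpace (tetraX 0) ρ) :=
    ⟨Submodule.fg_def.2 ⟨_, Set.finite_range _, hspan⟩⟩
  have hle : Module.finrank K (InducedSpace (tetraX 0) ρ) ≤ 4 := by
    rw [← finrank_top, ← hspan]
    exact (finrank_range_le_card _).trans_eq (Fintype.card_fin 4)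
  have hge := hli.fintype_card_le_finrank
  rw [Fintype.card_fin] at hge
  let B := basisOfLinearIndependentOfCardEqFinrank hli
    (by rw [Fintype.card_fin]; exact le_antisymm hge hle)
  have hB (j : Fin 4) : B j = M.action (tetraTransversal j) v := by
    simp [B]
  refine ⟨B, hB, fun i j => ?_⟩
  obtain ⟨h, hh, e⟩ := tetraX_mul_tetraTransversal i j
  rw [hB, hB, hB, M.braiding_tmul _ _ _ (hmem i), ← Module.End.mul_apply, ← map_mul, e, map_mul,
    Module.End.mul_apply, action_eq_self hs hρ hv hh]

end TetraModule

end

theorem proposition5 {K : Type u} [Field K] [CharP K 2] :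
    (∃ B : Module.Basis (Fin 36) K (TetraAlgebra K), ⇑B = tetraMonomials K) ∧
    ∀ {W : Type w} [AddCommGroup W] [Module K W]
      (ρ : Representation K (Subgroup.centralizer {tetraX 0}) W),
      IsAbsolutelySimple ρ →
      ρ ⟨tetraX 0, tetraX_self_mem⟩ = -1 →
      ρ ⟨tetraX 1 * tetraX 3, tetraX_mul_mem⟩ = 1 →
      ∀ v ∈ (inducedYD (tetraX 0) ρ).component (tetraX 0), v ≠ 0 →
        ∃ B : Module.Basis (Fin 4) K (InducedSpace (tetraX 0) ρ),
          ⇑B = ![v,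
            (inducedYD (tetraX 0) ρ).action (tetraX 2) v,
            (inducedYD (tetraX 0) ρ).action (tetraX 3) v,
            (inducedYD (tetraX 0) ρ).action (tetraX 1) v] ∧
          (∃! φ : NicholsAlgebra (inducedYD (tetraX 0) ρ).braiding ≃ₐ[K] TetraAlgebra K,
            ∀ i, φ (NicholsAlgebra.ι (inducedYD (tetraX 0) ρ).braiding (B i)) = tetraGen K i) ∧
          Module.finrank K (NicholsAlgebra (inducedYD (tetraX 0) ρ).braiding) = 36 := by
  refine ⟨exists_basis_tetraMonomials K, fun ρ hs hx hz v hv hv0 => ?_⟩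
  obtain ⟨B, hB, hc⟩ := exists_basis_isRackBraiding hs (rho_eq_one hx hz) hv hv0
  refine ⟨B, funext fun j => ?_, hc.existsUnique_algEquiv⟩
  rw [hB]
  fin_cases j
  · change (inducedYD (tetraX 0) ρ).action 1 v = v
    rw [map_one, Module.End.one_apply]
  all_goals rfl
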